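/- **Setting.** Consider quadratic regression with basis $f(x)=(1,x,x^2)^\top$, $x\in\mathbb{R}$. For real $a,b,c,d$ with $ad-bc\neq 0$ put $$\varphi(x;a,b,c,d)=\frac{ax+b}{cx+d},\qquad \sigma_P^2(x;a,b,c,d)=\bigl\{(b^2+d^2)+2(ab+cd)x+(a^2+c^2)x^2\bigr\}^2 ,$$ where $\varphi(\cdot;a,b,c,d)$ is regarded as a bijection of $\overline{\mathbb{R}}=\mathbb{R}\cup\{\infty\}$ (so $\infty\mapsto a/c$, $-d/c\mapsto\infty$; $\infty\mapsto\infty$ if $c=0$). At $x=\infty$ we use the conventions $f(\infty)=(0,0,1)^\top=\lim f(x)/x^2$ and $\sigma_P^2(\infty;a,b,c,d)=(a^2+c^2)^2=\lim\sigma_P^2(x;a,b,c,d)/x^4$. Fix $a_0,b_0,c_0,d_0$ with $a_0d_0-b_0c_0\ne0$ and take $\sigma_P^2(x;a_0,b_0,c_0,d_0)$ as the variance function of the regression. A finite measure $\rho$ on $\mathbb{R}$ has information matrix $M(\rho)=\int f(x)f(x)^\top\,\sigma_P^2(x;a_0,b_0,c_0,d_0)^{-1}\,\mathrm{d}\rho(x)$;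 let $\mathcal{M}$ be the set of all positive definite matrices of this form. A three-point design $\{x_i;p_i\}_{i=1,2,3}$ is a probability measure with masses $p_i>0$, $\sum_i p_i=1$, at three distinct points $x_i\in\overline{\mathbb{R}}$; its information matrix is $\sum_i p_i f(x_i)f(x_i)^\top/\sigma_P^2(x_i;a_0,b_0,c_0,d_0)$. For positive definite $\Sigma$ let $$\mathrm{Vol}_1(\gamma_\Sigma)=2\int_{\mathbb{R}}\Bigl\|\frac{\mathrm{d}}{\mathrm{d}x}\frac{\Sigma^{1/2}f(x)}{\|\Sigma^{1/2}f(x)\|}\Bigr\|\,\mathrm{d}x .$$ A design with information matrix $M$ is *tube-volume optimal* if $M\in\mathcal{M}$ and $\mathrm{Vol}_1(\gamma_{M^{-1}})\le \mathrm{Vol}_1(\gamma_{M'^{-1}})$ for all $M'\in\mathcal{M}$. It is *D-optimal* if $\det M\ge\det M(\rho)$ for every probability measure $\rho$ on $\mathbb{R}$. **Theorem.** Let $(t^0_1,t^0_2,t^0_3)=(-\tfrac13,0,\tfrac13)$. 1. The tube-volume optimal three-point designs are exactly the designs $\{x_i;p_i\}_{i=1,2,3}$ with $$x_i=\varphi^{-1}(\tan(\pi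 t^0_i);a,b,c,d),\qquad p_i=k\,\frac{\sigma_P^2(x_i;a_0,b_0,c_0,d_0)}{\sigma_P^2(x_i;a,b,c,d)},$$ where $a,b,c,d$ are arbitrary real numbers with $ad-bc\ne0$ and $k>0$ is the constant for which $\sum_i p_i=1$. 2. The D-optimal three-point designs are exactly the designs of this family for which $a,b,c,d$ satisfy, for some real $s,t$ with $s^2+t^2=1$, $$\varphi(\cdot;a,b,c,d)=\varphi(\cdot;s,-t,t,s)\circ\varphi(\cdot;a_0,b_0,c_0,d_0).$$ In particular, every D-optimal three-point design is tube-volume optimal. -/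

import Mathlib

open MeasureTheory Matrix OnePoint
open scoped MatrixOrder MatrixGroups

noncomputable section

namespace TubeDesign

/-- The polynomial regression basis `f_P(x) = (1, x, …, x^(n-1))` on the real line. -/
def polyBasis (n : ℕ) (x : ℝ) : Fin n → ℝ := fun i => x ^ (i : ℕ)

/-- The polynomial basis on the extended line `ℝ ∪ {∞}`, with the convention
`f_P(∞) = (0, …, 0, 1) = lim f_P(x) / x^(n-1)`. -/
def polyBasisExt (n : ℕ) : OnePoint ℝ → Fin n → ℝ
  | ∞ => fun i => if (i : ℕ) + 1 = n then 1 else 0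
  | OnePoint.some x => polyBasis n x

/-- The variance function `σ_P²(x; a, b, c, d)` where `(a, b; c, d)` are the entries of the
invertible matrix `g`. -/
def polyVar (n : ℕ) (g : GL (Fin 2) ℝ) (x : ℝ) : ℝ :=
  ((g 0 1 ^ 2 + g 1 1 ^ 2) + 2 * (g 0 0 * g 0 1 + g 1 0 * g 1 1) * x
    + (g 0 0 ^ 2 + g 1 0 ^ 2) * x ^ 2) ^ (n - 1)

/-- The variance function on `ℝ ∪ {∞}`; at `∞` it is scaled in the same way as the basis:
`σ_P²(∞; a, b, c, d) = (a² + c²)^(n-1) = lim σ_P²(x; a, b, c, d) / (x^(n-1))²`. -/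
def polyVarExt (n : ℕ) (g : GL (Fin 2) ℝ) : OnePoint ℝ → ℝ
  | ∞ => (g 0 0 ^ 2 + g 1 0 ^ 2) ^ (n - 1)
  | OnePoint.some x => polyVar n g x

/-- The information matrix `∫ f_P(x) f_P(x)ᵀ / σ_P²(x; g₀) dρ(x)` of a design measure on `ℝ`.
For a finite measure every entry of the integrand is bounded, hence integrable. -/
def infoMatrix (n : ℕ) (g₀ : GL (Fin 2) ℝ) (ρ : Measure ℝ) : Matrix (Fin n) (Fin n) ℝ :=
  Matrix.of fun i j => ∫ x, polyBasis n x i * polyBasis n x j / polyVar n g₀ x ∂ρ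

/-- The set of non-singular information matrices, over all finite measures on `ℝ`. -/
def infoCone (n : ℕ) (g₀ : GL (Fin 2) ℝ) : Set (Matrix (Fin n) (Fin n) ℝ) :=
  {M | M.PosDef ∧ ∃ ρ : Measure ℝ, IsFiniteMeasure ρ ∧ infoMatrix n g₀ ρ = M}

/-- The normalized basis vector `ψ_Σ(x) = Σ^(1/2) f_P(x) / ‖Σ^(1/2) f_P(x)‖` (Euclidean norm,
positive semidefinite square root). -/
def normalizedBasis (n : ℕ) (S : Matrix (Fin n) (Fin n) ℝ) (x : ℝ) : EuclideanSpace ℝ (Fin n) :=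
  ‖WithLp.toLp 2 (CFC.sqrt S *ᵥ polyBasis n x)‖⁻¹ • WithLp.toLp 2 (CFC.sqrt S *ᵥ polyBasis n x)

/-- The tube-volume criterion `Vol₁(γ_Σ) = 2 ∫ ‖dψ_Σ(x)/dx‖ dx`, the length of the curve
`γ_Σ = {±ψ_Σ(x)}`. -/
def tubeVolume (n : ℕ) (S : Matrix (Fin n) (Fin n) ℝ) : ℝ :=
  2 * ∫ x : ℝ, ‖deriv (normalizedBasis n S) x‖

/-- A finitely supported design on `ℝ ∪ {∞}`, given by its weights, is an `N`-point design if it is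
a probability measure whose support has exactly `N` points. -/
def IsPointDesign (N : ℕ) (ξ : OnePoint ℝ →₀ ℝ) : Prop :=
  (∀ x, 0 ≤ ξ x) ∧ (ξ.sum fun _ p => p) = 1 ∧ ξ.support.card = N

/-- The information matrix `∑ p_i f_P(x_i) f_P(x_i)ᵀ / σ_P²(x_i; g₀)` of a discrete design. -/
def designMatrix (n : ℕ) (g₀ : GL (Fin 2) ℝ) (ξ : OnePoint ℝ →₀ ℝ) : Matrix (Fin n) (Fin n) ℝ :=
  ξ.sum fun x p => (p / polyVarExt n g₀ x) • vecMulVec (polyBasisExt n x) (polyBasisExt n x)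

/-- A discrete design is tube-volume optimal if its information matrix `M` minimizes
`Vol₁(γ_{M⁻¹})` over all non-singular information matrices. -/
def IsTubeVolumeOptimal (n : ℕ) (g₀ : GL (Fin 2) ℝ) (ξ : OnePoint ℝ →₀ ℝ) : Prop :=
  designMatrix n g₀ ξ ∈ infoCone n g₀ ∧
    ∀ M ∈ infoCone n g₀, tubeVolume n (designMatrix n g₀ ξ)⁻¹ ≤ tubeVolume n M⁻¹

/-- A discrete design is D-optimal if it maximizes the determinant of the information matrix (that
is, minimizes `det Σ`, `Σ = M⁻¹`) among all probability measures on `ℝ`. -/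
def IsDOptimal (n : ℕ) (g₀ : GL (Fin 2) ℝ) (ξ : OnePoint ℝ →₀ ℝ) : Prop :=
  ∀ ρ : Measure ℝ, IsProbabilityMeasure ρ →
    (infoMatrix n g₀ ρ).det ≤ (designMatrix n g₀ ξ).det

/-- The support points `t⁰_1, …, t⁰_n` of the uniform Fourier design, `t⁰_i = i/n - (n+1)/(2n)`;
the index `i : Fin n` stands for `i + 1`. -/
def uniformPoint (n : ℕ) (i : Fin n) : ℝ := ((i : ℝ) + 1) / n - (n + 1) / (2 * n)

/-- `x_i = φ⁻¹(tan(π t⁰_i); a, b, c, d)`. The Möbius transformation `φ(·; a, b, c, d)` of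
`ℝ ∪ {∞}` is the action of the matrix `g = (a, b; c, d)`. -/
def designPoint (n : ℕ) (g : GL (Fin 2) ℝ) (i : Fin n) : OnePoint ℝ :=
  g⁻¹ • ((Real.tan (Real.pi * uniformPoint n i) : ℝ) : OnePoint ℝ)

/-- The unnormalized weight `σ_P²(x_i; g₀) / σ_P²(x_i; g)`. -/
def designRatio (n : ℕ) (g₀ g : GL (Fin 2) ℝ) (i : Fin n) : ℝ :=
  polyVarExt n g₀ (designPoint n g i) / polyVarExt n g (designPoint n g i)

/-- The design with points `x_i` and weights `p_i = k σ_P²(x_i; g₀) / σ_P²(x_i; g)`, where `k` is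
the normalizing constant for `∑ p_i = 1`. -/
def mobiusDesign (n : ℕ) (g₀ g : GL (Fin 2) ℝ) : OnePoint ℝ →₀ ℝ :=
  ∑ i, Finsupp.single (designPoint n g i) (designRatio n g₀ g i / ∑ j, designRatio n g₀ g j)

/-- `r` is one of the matrices `(s, -t; t, s)` with `s² + t² = 1`. -/
def IsRotation (r : GL (Fin 2) ℝ) : Prop :=
  ∃ s t : ℝ, s ^ 2 + t ^ 2 = 1 ∧ (r : Matrix (Fin 2) (Fin 2) ℝ) = !![s, -t; t, s]

end TubeDesign

end

/-!
Attach to a moment sequence `m` the binary quartic `Q(X, Y) = ∫ (X - Y z)⁴ dμ(z)`. Three covariants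
carry the proof: `Q` itself, its catalecticant `J = det M` for the Hankel matrix `M` of `m`, and its
Hessian `H = fᵀ adj(M) f`. The curve `γ_Σ` with `Σ = M⁻¹` has speed `√(J Q) / H`
(`TubeDesign.tubeVolume_hankel_inv`), and `∫ √(J Q) / H dx` is invariant under `GL₂(ℝ)` acting
through Möbius transformations of the line (`TubeDesign.curveLength_changeVar`).

A quartic with positive definite `M` is a product of two positive definite quadratic forms.
Diagonalizing these simultaneously brings `Q` to the form `X⁴ + 6cX²Y² + Y⁴` with `0 < c < 1`
(`TubeDesign.exists_normalMoments`), so that a one-parameter family of elliptic integrals has to be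
minimized. The tangent bound `√r ≥ 2rp / (r + p²)`, with `p` a suitable multiple of `x² + 1`, turns
the integrand into a difference of two fractions `(x² + 1) / (a (x² - 1)² + b x²)`, each with
integral `2π / √(ab)`. The resulting lower bound exceeds the value at `c = 1/3` because
`70 (3c - 1)² > 0` for `c ≠ 1/3` (`TubeDesign.curveLength_normalMoments_gt`). Hence the minimizers
are exactly the `M` whose quartic form is a multiple of `|g ·|⁴` for some `g ∈ GL₂(ℝ)`
(`TubeDesign.isTubeVolumeOptimal_iff`).

Similarly, the D-optimal designs are those whose quartic form is a multiple of `|g₀ ·|⁴`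
(`TubeDesign.isDOptimal_iff`). Pushed forward by `g₀`, an information matrix is the matrix of a
probability measure in the basis `1, cos 2θ, sin 2θ`, and the claim is Hadamard's inequality
followed by the inequality between the arithmetic and the geometric mean.

Finally, a three-point design with quartic form `κ |g ·|⁴` can be rotated so that one of its points
is sent to `0`; comparing coefficients, the other two are sent to `±√3 = tan (±π/3)` and all weights
relative to `σ_P²(·; g)` agree (`TubeDesign.exists_eq_mobiusDesign`). Conversely each Möbius design
has such a quartic form. After a rotation its three points avoid `∞`, which realizes the matrix by
a measure on the real line (`TubeDesign.IsNormSquare.exists_infoMoments_eq`).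
-/

namespace TubeDesign

/-! ### Hankel matrices and binary quartic forms -/

/-- The Hankel matrix `(m_{i+j})` of a sequence of moments of order at most four. -/
def hankel (m : Fin 5 → ℝ) : Matrix (Fin 3) (Fin 3) ℝ :=
  !![m 0, m 1, m 2; m 1, m 2, m 3; m 2, m 3, m 4]

/-- The binary quartic form attached to a moment sequence. If `m` is the moment sequence of a
measure `μ` on the line, this is `∫ (X - Y z)⁴ dμ(z)`. -/
def quartic (m : Fin 5 → ℝ) (X Y : ℝ) : ℝ :=
  m 0 * X ^ 4 - 4 * m 1 * X ^ 3 * Y + 6 * m 2 * X ^ 2 * Y ^ 2 - 4 * m 3 * X * Y ^ 3 + m 4 * Y ^ 4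

/-- The catalecticant `det (hankel m)` of the quartic form. -/
def catalecticant (m : Fin 5 → ℝ) : ℝ :=
  m 0 * m 2 * m 4 + 2 * m 1 * m 2 * m 3 - m 2 ^ 3 - m 0 * m 3 ^ 2 - m 1 ^ 2 * m 4

/-- The Hessian covariant of the quartic form, up to a constant factor; it equals
`fᵀ adj(hankel m) f` for `f = (Y², XY, X²)`. -/
def hessian (m : Fin 5 → ℝ) (X Y : ℝ) : ℝ :=
  (m 2 * m 4 - m 3 ^ 2) * Y ^ 4 + 2 * (m 2 * m 3 - m 1 * m 4) * X * Y ^ 3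
    + (2 * (m 1 * m 3 - m 2 ^ 2) + (m 0 * m 4 - m 2 ^ 2)) * X ^ 2 * Y ^ 2
    + 2 * (m 1 * m 2 - m 0 * m 3) * X ^ 3 * Y + (m 0 * m 2 - m 1 ^ 2) * X ^ 4

/-- The moment sequence whose quartic form is `quartic m (aX + bY) (cX + dY)`. -/
def changeVar (a b c d : ℝ) (m : Fin 5 → ℝ) : Fin 5 → ℝ :=
  ![m 0 * a ^ 4 - 4 * m 1 * a ^ 3 * c + 6 * m 2 * a ^ 2 * c ^ 2 - 4 * m 3 * a * c ^ 3
      + m 4 * c ^ 4,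
    -(m 0 * a ^ 3 * b - m 1 * (3 * a ^ 2 * b * c + a ^ 3 * d)
      + 3 * m 2 * (a ^ 2 * c * d + a * b * c ^ 2) - m 3 * (b * c ^ 3 + 3 * a * c ^ 2 * d)
      + m 4 * c ^ 3 * d),
    m 0 * a ^ 2 * b ^ 2 - 2 * m 1 * (a ^ 2 * b * d + a * b ^ 2 * c)
      + m 2 * (a ^ 2 * d ^ 2 + 4 * a * b * c * d + b ^ 2 * c ^ 2)
      - 2 * m 3 * (a * c * d ^ 2 + b * c ^ 2 * d) + m 4 * c ^ 2 * d ^ 2,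
    -(m 0 * a * b ^ 3 - m 1 * (b ^ 3 * c + 3 * a * b ^ 2 * d)
      + 3 * m 2 * (a * b * d ^ 2 + b ^ 2 * c * d) - m 3 * (a * d ^ 3 + 3 * b * c * d ^ 2)
      + m 4 * c * d ^ 3),
    m 0 * b ^ 4 - 4 * m 1 * b ^ 3 * d + 6 * m 2 * b ^ 2 * d ^ 2 - 4 * m 3 * b * d ^ 3
      + m 4 * d ^ 4]

/-- The congruence matrix through which a linear change of variables acts on Hankel matrices. -/
def symSquare (a b c d : ℝ) : Matrix (Fin 3) (Fin 3) ℝ :=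
  !![a ^ 2, -2 * a * c, c ^ 2; -(a * b), a * d + b * c, -(c * d); b ^ 2, -2 * b * d, d ^ 2]

lemma hankel_det (m : Fin 5 → ℝ) : (hankel m).det = catalecticant m := by
  simp [hankel, catalecticant, Matrix.det_fin_three]
  ring

lemma hankel_changeVar (a b c d : ℝ) (m : Fin 5 → ℝ) :
    hankel (changeVar a b c d m) = symSquare a b c d * hankel m * (symSquare a b c d)ᵀ := by
  ext i j
  fin_cases i <;> fin_cases j <;>
    simp [hankel, changeVar, symSquare, Matrix.mul_apply, Fin.sum_univ_three] <;> ring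

lemma symSquare_det (a b c d : ℝ) : (symSquare a b c d).det = (a * d - b * c) ^ 3 := by
  simp [symSquare, Matrix.det_fin_three]
  ring

lemma quartic_changeVar (a b c d : ℝ) (m : Fin 5 → ℝ) (X Y : ℝ) :
    quartic (changeVar a b c d m) X Y = quartic m (a * X + b * Y) (c * X + d * Y) := by
  simp [quartic, changeVar]
  ring

lemma catalecticant_changeVar (a b c d : ℝ) (m : Fin 5 → ℝ) :
    catalecticant (changeVar a b c d m) = (a * d - b * c) ^ 6 * catalecticant m := by
  rw [← hankel_det, hankel_changeVar, Matrix.det_mul, Matrix.det_mul, Matrix.det_transpose,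
    symSquare_det, hankel_det]
  ring

lemma hessian_changeVar (a b c d : ℝ) (m : Fin 5 → ℝ) (X Y : ℝ) :
    hessian (changeVar a b c d m) X Y
      = (a * d - b * c) ^ 2 * hessian m (a * X + b * Y) (c * X + d * Y) := by
  simp [hessian, changeVar]
  ring

/-- A quartic form determines its moment sequence. -/
lemma quartic_injective {m m' : Fin 5 → ℝ} (h : ∀ X Y, quartic m X Y = quartic m' X Y) :
    m = m' := by
  have h1 := h 1 0
  have h2 := h 0 1
  have h3 := h 1 1
  have h4 := h 1 (-1)
  have h5 := h 1 2
  simp only [quartic] at h1 h2 h3 h4 h5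
  ext i
  fin_cases i <;> simp <;> linarith

lemma hankel_posDef_iff (m : Fin 5 → ℝ) : (hankel m).PosDef ↔ ∀ x y z : ℝ,
    x ≠ 0 ∨ y ≠ 0 ∨ z ≠ 0 → 0 < m 0 * x ^ 2 + 2 * m 1 * x * y + m 2 * (y ^ 2 + 2 * x * z)
      + 2 * m 3 * y * z + m 4 * z ^ 2 := by
  have hH : (hankel m).IsHermitian := by
    ext i j
    fin_cases i <;> fin_cases j <;> simp [hankel]
  rw [Matrix.posDef_iff_dotProduct_mulVec]
  constructor
  · intro h x y z hxyz
    have := h.2 (x := ![x, y, z]) (by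
      intro h0
      have h1 := congrFun h0 0
      have h2 := congrFun h0 1
      have h3 := congrFun h0 2
      simp at h1 h2 h3
      simp_all)
    simp [hankel, Matrix.mulVec, dotProduct, Fin.sum_univ_three] at this
    linarith
  · intro h
    refine ⟨hH, fun v hv => ?_⟩
    have hv' : v 0 ≠ 0 ∨ v 1 ≠ 0 ∨ v 2 ≠ 0 := by
      by_contra! hc
      apply hv
      ext i
      fin_cases i <;> simp [hc]
    have := h _ _ _ hv'
    simp [hankel, Matrix.mulVec, dotProduct, Fin.sum_univ_three]
    linarith

lemma hankel_changeVar_posDef {a b c d : ℝ} (hg : a * d - b * c ≠ 0) {m : Fin 5 → ℝ}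
    (hm : (hankel m).PosDef) : (hankel (changeVar a b c d m)).PosDef := by
  rw [hankel_changeVar]
  have hu : IsUnit (symSquare a b c d) := by
    rw [Matrix.isUnit_iff_isUnit_det, symSquare_det]
    exact (isUnit_iff_ne_zero.mpr (pow_ne_zero 3 hg))
  have := (Matrix.IsUnit.posDef_star_right_conjugate_iff hu (x := hankel m)).mpr hm
  simpa [Matrix.star_eq_conjTranspose] using this

lemma catalecticant_pos {m : Fin 5 → ℝ} (hm : (hankel m).PosDef) : 0 < catalecticant m :=
  hankel_det m ▸ hm.det_pos

lemma quartic_pos {m : Fin 5 → ℝ} (hm : (hankel m).PosDef) {X Y : ℝ} (h : X ≠ 0 ∨ Y ≠ 0) :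
    0 < quartic m X Y := by
  have := (hankel_posDef_iff m).mp hm (X ^ 2) (-2 * X * Y) (Y ^ 2) (by
    rcases h with h | h
    · exact Or.inl (pow_ne_zero 2 h)
    · exact Or.inr (Or.inr (pow_ne_zero 2 h)))
  simp only [quartic]
  linarith

/-! ### Normal form of a positive binary quartic -/

lemma exists_monic_quadratic_factors {p q r s : ℝ} :
    ∃ α β γ δ : ℝ, ∀ x : ℝ, x ^ 4 + p * x ^ 3 + q * x ^ 2 + r * x + s
      = (x ^ 2 + α * x + β) * (x ^ 2 + γ * x + δ) := by
  have hf : Polynomial.IsMonicOfDegree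
      (Polynomial.X ^ 4 + Polynomial.C p * Polynomial.X ^ 3 + Polynomial.C q * Polynomial.X ^ 2
        + Polynomial.C r * Polynomial.X + Polynomial.C s) (2 + 2) := by
    rw [Polynomial.isMonicOfDegree_iff]
    constructor
    · compute_degree
    · simp
  obtain ⟨f₁, f₂, h₁, h₂, h⟩ := hf.eq_isMonicOfDegree_two_mul_isMonicOfDegree
  obtain ⟨α, β, rfl⟩ := Polynomial.isMonicOfDegree_two_iff.mp h₁
  obtain ⟨γ, δ, rfl⟩ := Polynomial.isMonicOfDegree_two_iff.mp h₂
  refine ⟨α, β, γ, δ, fun x => ?_⟩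
  have := congrArg (Polynomial.eval x) h
  simpa using this

/-- Two binary quadratic forms, the first of which is positive definite, can be diagonalized
simultaneously. -/
lemma exists_simultaneous_diagonalization {α β : ℝ} (hβ : 0 < β - α ^ 2 / 4) (γ δ : ℝ) :
    ∃ a b c d l₁ n₁ l₂ n₂ : ℝ, a * d - b * c ≠ 0 ∧
      (∀ X Y : ℝ, (a * X + b * Y) ^ 2 + α * (a * X + b * Y) * (c * X + d * Y)
        + β * (c * X + d * Y) ^ 2 = l₁ * X ^ 2 + n₁ * Y ^ 2) ∧
      (∀ X Y : ℝ, (a * X + b * Y) ^ 2 + γ * (a * X + b * Y) * (c * X + d * Y)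
        + δ * (c * X + d * Y) ^ 2 = l₂ * X ^ 2 + n₂ * Y ^ 2) := by
  -- In the coordinates in which the first form is `X² + κ Y²`, the second one is
  -- `X² + 2 B X Y + C Y²`.
  set κ := β - α ^ 2 / 4 with hκ
  set B := (γ - α) / 2 with hB
  set C := α ^ 2 / 4 - γ * α / 2 + δ with hC
  -- The vectors `(1, z)` and `(-κ z, 1)` are conjugate for the first form; for the second one this
  -- is a quadratic equation for `z`.
  obtain ⟨z, hz⟩ : ∃ z : ℝ, B * κ * z ^ 2 + (κ - C) * z - B = 0 := by
    by_cases hB0 : B = 0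
    · exact ⟨0, by simp [hB0]⟩
    · have hD : 0 ≤ (κ - C) ^ 2 + 4 * B ^ 2 * κ := by positivity
      refine ⟨(-(κ - C) + √((κ - C) ^ 2 + 4 * B ^ 2 * κ)) / (2 * (B * κ)), ?_⟩
      have hs := Real.sq_sqrt hD
      set w := √((κ - C) ^ 2 + 4 * B ^ 2 * κ)
      field_simp
      linear_combination hs
  have e1 : β = κ + α ^ 2 / 4 := by rw [hκ]; ring
  have e2 : γ = 2 * B + α := by rw [hB]; ring
  have e3 : δ = C - α ^ 2 / 4 + (2 * B + α) * α / 2 := by rw [hC, hB]; ring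
  refine ⟨1 - α / 2 * z, -κ * z - α / 2, z, 1, 1 + κ * z ^ 2, κ ^ 2 * z ^ 2 + κ,
    1 + 2 * B * z + C * z ^ 2, κ ^ 2 * z ^ 2 - 2 * B * κ * z + C, ?_, ?_, ?_⟩
  · have : 0 < 1 + κ * z ^ 2 := by positivity
    nlinarith
  · intro X Y
    rw [e1]
    ring
  · intro X Y
    rw [e3, e2]
    linear_combination (-2 * X * Y) * hz

lemma exists_pow_four_mul_eq_one {r : ℝ} (hr : 0 < r) : ∃ s : ℝ, 0 < s ∧ r * s ^ 4 = 1 := by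
  refine ⟨(√(√r))⁻¹, by positivity, ?_⟩
  have h : √(√r) ^ 4 = r := by
    rw [show √(√r) ^ 4 = ((√(√r)) ^ 2) ^ 2 by ring, Real.sq_sqrt (Real.sqrt_nonneg r),
      Real.sq_sqrt hr.le]
  rw [inv_pow, h]
  exact mul_inv_cancel₀ hr.ne'

lemma monic_quadratic_pos {m : Fin 5 → ℝ} (hm : (hankel m).PosDef) {α β γ δ : ℝ}
    (hq : ∀ x, quartic m x 1 = m 0 * ((x ^ 2 + α * x + β) * (x ^ 2 + γ * x + δ))) :
    0 < β - α ^ 2 / 4 := by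
  by_contra! hβ
  have hs := Real.sq_sqrt (show 0 ≤ α ^ 2 / 4 - β by linarith)
  have hpos := quartic_pos hm (X := -α / 2 + √(α ^ 2 / 4 - β)) (Y := 1) (Or.inr one_ne_zero)
  rw [hq] at hpos
  have : (-α / 2 + √(α ^ 2 / 4 - β)) ^ 2 + α * (-α / 2 + √(α ^ 2 / 4 - β)) + β = 0 := by
    linear_combination hs
  rw [this] at hpos
  simp at hpos

/-- The moment sequence with quartic form `X⁴ + 6cX²Y² + Y⁴`. -/
def normalMoments (c : ℝ) : Fin 5 → ℝ := ![1, 0, c, 0, 1]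

lemma normalMoments_bounds {c : ℝ} (h : (hankel (normalMoments c)).PosDef) : 0 < c ∧ c < 1 := by
  rw [hankel_posDef_iff] at h
  have h1 := h 0 1 0 (by simp)
  have h2 := h 1 0 (-1) (by simp)
  simp [normalMoments] at h1 h2
  constructor <;> linarith

/-- Every quartic form with positive definite Hankel matrix is linearly equivalent to
`X⁴ + 6cX²Y² + Y⁴` with `0 < c < 1`: it is a product of two positive definite quadratic forms, and
these can be diagonalized simultaneously. -/
lemma exists_normalMoments {m : Fin 5 → ℝ} (hm : (hankel m).PosDef) :
    ∃ a b c d κ : ℝ, a * d - b * c ≠ 0 ∧ 0 < κ ∧ κ < 1 ∧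
      changeVar a b c d m = normalMoments κ := by
  have h0 : 0 < m 0 := by
    have := quartic_pos hm (X := 1) (Y := 0) (Or.inl one_ne_zero)
    simpa [quartic] using this
  obtain ⟨α, β, γ, δ, hfac⟩ := exists_monic_quadratic_factors (p := -4 * m 1 / m 0)
    (q := 6 * m 2 / m 0) (r := -4 * m 3 / m 0) (s := m 4 / m 0)
  have hq : ∀ x, quartic m x 1 = m 0 * ((x ^ 2 + α * x + β) * (x ^ 2 + γ * x + δ)) := by
    intro x
    rw [← hfac]
    simp only [quartic]
    field_simp
    ring
  have hβ := monic_quadratic_pos hm hq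
  have hδ := monic_quadratic_pos hm (α := γ) (β := δ) (γ := α) (δ := β)
    (fun x => by rw [hq, mul_comm (x ^ 2 + α * x + β)])
  have hQ : ∀ X Y, quartic m X Y
      = m 0 * ((X ^ 2 + α * X * Y + β * Y ^ 2) * (X ^ 2 + γ * X * Y + δ * Y ^ 2)) := by
    have e0 := hq 0
    have e1 := hq 1
    have e2 := hq (-1)
    have e3 := hq 2
    simp only [quartic] at e0 e1 e2 e3
    intro X Y
    simp only [quartic]
    have c4 : m 4 = m 0 * (β * δ) := by linarith
    have c2 : 6 * m 2 = m 0 * (β + δ + α * γ) := by linarith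
    have c1 : -4 * m 1 = m 0 * (α + γ) := by linarith
    have c3 : -4 * m 3 = m 0 * (α * δ + β * γ) := by linarith
    linear_combination X ^ 3 * Y * c1 + X ^ 2 * Y ^ 2 * c2 + X * Y ^ 3 * c3 + Y ^ 4 * c4
  obtain ⟨a, b, c, d, l₁, n₁, l₂, n₂, hdet, hd₁, hd₂⟩ :=
    exists_simultaneous_diagonalization hβ γ δ
  have hQ' : ∀ X Y, quartic m (a * X + b * Y) (c * X + d * Y)
      = m 0 * ((l₁ * X ^ 2 + n₁ * Y ^ 2) * (l₂ * X ^ 2 + n₂ * Y ^ 2)) := by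
    intro X Y
    rw [hQ, hd₁, hd₂]
  have hac : a ≠ 0 ∨ c ≠ 0 := by
    by_contra! hc
    simp [hc] at hdet
  have hbd : b ≠ 0 ∨ d ≠ 0 := by
    by_contra! hc
    simp [hc] at hdet
  have hl : 0 < m 0 * (l₁ * l₂) := by
    have := quartic_pos hm hac
    have e := hQ' 1 0
    simp at e
    rwa [e] at this
  have hn : 0 < m 0 * (n₁ * n₂) := by
    have := quartic_pos hm hbd
    have e := hQ' 0 1
    simp at e
    rwa [e] at this
  obtain ⟨s, hs, hs1⟩ := exists_pow_four_mul_eq_one hl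
  obtain ⟨t, ht, ht1⟩ := exists_pow_four_mul_eq_one hn
  have hdet' : a * s * (d * t) - b * t * (c * s) ≠ 0 := by
    rw [show a * s * (d * t) - b * t * (c * s) = (a * d - b * c) * (s * t) by ring]
    exact mul_ne_zero hdet (by positivity)
  have hnf : changeVar (a * s) (b * t) (c * s) (d * t) m
      = normalMoments (m 0 * (l₁ * n₂ + n₁ * l₂) * s ^ 2 * t ^ 2 / 6) := by
    apply quartic_injective
    intro X Y
    rw [quartic_changeVar, show a * s * X + b * t * Y = a * (s * X) + b * (t * Y) by ring,
      show c * s * X + d * t * Y = c * (s * X) + d * (t * Y) by ring, hQ']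
    simp [quartic, normalMoments]
    linear_combination X ^ 4 * hs1 + Y ^ 4 * ht1
  have hbounds := normalMoments_bounds (hnf ▸ hankel_changeVar_posDef hdet' hm)
  exact ⟨_, _, _, _, _, hdet', hbounds.1, hbounds.2, hnf⟩

/-! ### A rational integral -/

section RationalIntegral

variable {a b : ℝ}

lemma sq_sub_one_form_pos (ha : 0 < a) (hb : 0 < b) (x : ℝ) :
    0 < a * (x ^ 2 - 1) ^ 2 + b * x ^ 2 := by
  rcases eq_or_ne x 0 with rfl | hx
  · simpa using ha
  · positivity

/-- The primitive on `[0, ∞)` of `(x² + 1) / (a (x² - 1)² + b x²)`, extended to `0` by its limit. -/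
noncomputable def reciprocalArctan (a b x : ℝ) : ℝ :=
  if x = 0 then -(Real.pi / 2) / √(a * b)
  else Real.arctan (√(a / b) * (x - x⁻¹)) / √(a * b)

lemma hasDerivAt_reciprocalArctan (ha : 0 < a) (hb : 0 < b) {x : ℝ} (hx : 0 < x) :
    HasDerivAt (reciprocalArctan a b)
      ((x ^ 2 + 1) / (a * (x ^ 2 - 1) ^ 2 + b * x ^ 2)) x := by
  have h1 : HasDerivAt (fun y : ℝ => √(a / b) * (y - y⁻¹)) (√(a / b) * (1 - -(x ^ 2)⁻¹)) x :=
    ((hasDerivAt_id x).sub (hasDerivAt_inv hx.ne')).const_mul _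
  have h2 := (h1.arctan).div_const √(a * b)
  have heq : reciprocalArctan a b
      =ᶠ[nhds x] fun y => Real.arctan (√(a / b) * (y - y⁻¹)) / √(a * b) := by
    filter_upwards [eventually_ne_nhds hx.ne'] with y hy
    simp [reciprocalArctan, hy]
  refine (h2.congr_of_eventuallyEq heq).congr_deriv ?_
  have hs : √(a / b) ^ 2 = a / b := Real.sq_sqrt (by positivity)
  have hab : √(a * b) = b * √(a / b) := by
    rw [show a * b = b ^ 2 * (a / b) by field_simp, Real.sqrt_mul (by positivity),
      Real.sqrt_sq hb.le]
  have hpos := sq_sub_one_form_pos ha hb x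
  have hpos' : 0 < √(a / b) := Real.sqrt_pos.mpr (by positivity)
  rw [hab, mul_pow, hs]
  have hd : 1 + a / b * (x - x⁻¹) ^ 2 = (a * (x ^ 2 - 1) ^ 2 + b * x ^ 2) / (b * x ^ 2) := by
    field_simp
    ring
  rw [hd]
  field_simp
  ring

lemma continuousWithinAt_reciprocalArctan (ha : 0 < a) (hb : 0 < b) :
    ContinuousWithinAt (reciprocalArctan a b) (Set.Ici 0) 0 := by
  rw [← Set.Ioi_insert, continuousWithinAt_insert_self]
  have hpos : 0 < √(a / b) := Real.sqrt_pos.mpr (by positivity)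
  have h1 : Filter.Tendsto (fun y : ℝ => y - y⁻¹) (nhdsWithin 0 (Set.Ioi 0)) Filter.atBot := by
    have hid : Filter.Tendsto (fun y : ℝ => y) (nhdsWithin 0 (Set.Ioi 0)) (nhds 0) :=
      tendsto_nhdsWithin_of_tendsto_nhds Filter.tendsto_id
    have hinv : Filter.Tendsto (fun y : ℝ => -y⁻¹) (nhdsWithin 0 (Set.Ioi 0)) Filter.atBot :=
      Filter.tendsto_neg_atTop_atBot.comp tendsto_inv_nhdsGT_zero
    exact (hid.add_atBot hinv).congr (fun y => (sub_eq_add_neg _ _).symm)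
  have h2 : Filter.Tendsto (fun y : ℝ => √(a / b) * (y - y⁻¹)) (nhdsWithin 0 (Set.Ioi 0))
      Filter.atBot := h1.const_mul_atBot hpos
  have h3 := (((Real.tendsto_arctan_atBot.mono_right nhdsWithin_le_nhds).comp h2).div_const
    √(a * b))
  rw [ContinuousWithinAt]
  have h0 : reciprocalArctan a b 0 = -(Real.pi / 2) / √(a * b) := by simp [reciprocalArctan]
  rw [h0]
  refine h3.congr' ?_
  filter_upwards [self_mem_nhdsWithin] with y hy
  simp [reciprocalArctan, (Set.mem_Ioi.mp hy).ne']

lemma tendsto_reciprocalArctan (ha : 0 < a) (hb : 0 < b) :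
    Filter.Tendsto (reciprocalArctan a b) Filter.atTop (nhds (Real.pi / 2 / √(a * b))) := by
  have hpos : 0 < √(a / b) := Real.sqrt_pos.mpr (by positivity)
  have h1 : Filter.Tendsto (fun y : ℝ => y - y⁻¹) Filter.atTop Filter.atTop := by
    have := Filter.tendsto_id.atTop_add (tendsto_inv_atTop_zero (𝕜 := ℝ)).neg
    exact this.congr (fun y => (sub_eq_add_neg _ _).symm)
  have h2 : Filter.Tendsto (fun y : ℝ => √(a / b) * (y - y⁻¹)) Filter.atTop
      Filter.atTop := h1.const_mul_atTop hpos
  have h3 := (((Real.tendsto_arctan_atTop.mono_right nhdsWithin_le_nhds).comp h2).div_const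
    √(a * b))
  refine h3.congr' ?_
  filter_upwards [Filter.eventually_gt_atTop 0] with y hy
  simp [reciprocalArctan, hy.ne']

lemma integrableOn_sq_add_one_div (ha : 0 < a) (hb : 0 < b) :
    IntegrableOn (fun x : ℝ => (x ^ 2 + 1) / (a * (x ^ 2 - 1) ^ 2 + b * x ^ 2)) (Set.Ioi 0) :=
  integrableOn_Ioi_deriv_of_nonneg (continuousWithinAt_reciprocalArctan ha hb)
    (fun _ hx => hasDerivAt_reciprocalArctan ha hb hx)
    (fun x _ => div_nonneg (by positivity) (sq_sub_one_form_pos ha hb x).le)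
    (tendsto_reciprocalArctan ha hb)

lemma integrable_sq_add_one_div (ha : 0 < a) (hb : 0 < b) :
    Integrable (fun x : ℝ => (x ^ 2 + 1) / (a * (x ^ 2 - 1) ^ 2 + b * x ^ 2)) := by
  have h := integrableOn_sq_add_one_div ha hb
  rw [← integrableOn_univ, ← Set.Iic_union_Ioi (a := (0 : ℝ)), integrableOn_union]
  refine ⟨?_, h⟩
  rw [integrableOn_Iic_iff_integrableOn_Iio]
  have := IntegrableOn.comp_neg_Iio (c := (0 : ℝ))
    (f := fun x : ℝ => (x ^ 2 + 1) / (a * (x ^ 2 - 1) ^ 2 + b * x ^ 2)) (by rwa [neg_zero])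
  simpa only [neg_sq] using this

lemma integral_sq_add_one_div (ha : 0 < a) (hb : 0 < b) :
    ∫ x : ℝ, (x ^ 2 + 1) / (a * (x ^ 2 - 1) ^ 2 + b * x ^ 2) = 2 * Real.pi / √(a * b) := by
  have h := integral_comp_abs
    (f := fun x : ℝ => (x ^ 2 + 1) / (a * (x ^ 2 - 1) ^ 2 + b * x ^ 2))
  simp only [sq_abs] at h
  rw [h, integral_Ioi_of_hasDerivAt_of_tendsto (continuousWithinAt_reciprocalArctan ha hb)
    (fun _ hx => hasDerivAt_reciprocalArctan ha hb hx) (integrableOn_sq_add_one_div ha hb)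
    (tendsto_reciprocalArctan ha hb)]
  simp [reciprocalArctan]
  ring

end RationalIntegral

/-! ### The length integral of the normal form -/

/-- Half of the tube volume of `(hankel m)⁻¹`, written in terms of the quartic form, its Hessian and
its catalecticant. -/
noncomputable def curveLength (m : Fin 5 → ℝ) : ℝ :=
  ∫ x : ℝ, √(catalecticant m * quartic m x 1) / hessian m x 1

lemma catalecticant_normalMoments (c : ℝ) :
    catalecticant (normalMoments c) = c * (1 - c) * (1 + c) := by
  simp [catalecticant, normalMoments]
  ring

lemma quartic_normalMoments (c x : ℝ) :
    quartic (normalMoments c) x 1 = (x ^ 2 - 1) ^ 2 + (2 + 6 * c) * x ^ 2 := by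
  simp [quartic, normalMoments]
  ring

lemma hessian_normalMoments (c x : ℝ) :
    hessian (normalMoments c) x 1
      = c * (x ^ 2 - 1) ^ 2 + (1 - c) * (1 + 3 * c) * x ^ 2 := by
  simp [hessian, normalMoments]
  ring

section NormalForm

variable {c : ℝ}

/-- The tangent bound `√r ≥ 2 r p / (r + p²)` applied to the integrand of the length integral. The
choice of `p = P (x² + 1)` makes the right-hand side a difference of two simple fractions. -/
lemma normal_integrand_ge (h0 : 0 < c) (h1 : c < 1) (x : ℝ) :
    2 * √(2 / 3 * (c * (1 - c) * (1 + 3 * c)))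
        * (3 / 5 * ((x ^ 2 + 1) / (c * (x ^ 2 - 1) ^ 2 + (1 - c) * (1 + 3 * c) * x ^ 2))
          - 4 / 5 * ((x ^ 2 + 1) / ((5 / 3 + 3 * c) * (x ^ 2 - 1) ^ 2
            + (1 + 3 * c) * (14 / 3 + 2 * c) * x ^ 2)))
      ≤ √(catalecticant (normalMoments c) * quartic (normalMoments c) x 1)
          / hessian (normalMoments c) x 1 := by
  rw [catalecticant_normalMoments, quartic_normalMoments, hessian_normalMoments]
  have hc1 : 0 < 1 - c := by linarith
  have hh := sq_sub_one_form_pos h0 (show 0 < (1 - c) * (1 + 3 * c) by positivity) x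
  have hE := sq_sub_one_form_pos (show 0 < 5 / 3 + 3 * c by positivity)
    (show 0 < (1 + 3 * c) * (14 / 3 + 2 * c) by positivity) x
  have hq := sq_sub_one_form_pos one_pos (show 0 < 2 + 6 * c by positivity) x
  rw [one_mul] at hq
  set h := c * (x ^ 2 - 1) ^ 2 + (1 - c) * (1 + 3 * c) * x ^ 2 with hh_def
  set E := (5 / 3 + 3 * c) * (x ^ 2 - 1) ^ 2 + (1 + 3 * c) * (14 / 3 + 2 * c) * x ^ 2 with hE_def
  set q := (x ^ 2 - 1) ^ 2 + (2 + 6 * c) * x ^ 2 with hq_def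
  set P := √(2 / 3 * (c * (1 - c) * (1 + 3 * c))) with hP
  have hP2 : P ^ 2 = 2 / 3 * (c * (1 - c) * (1 + 3 * c)) := Real.sq_sqrt (by positivity)
  set R := √(c * (1 - c) * (1 + c) * q) with hR
  have hR2 : R ^ 2 = c * (1 - c) * (1 + c) * q := Real.sq_sqrt (by positivity)
  have hR0 : 0 < R := Real.sqrt_pos.mpr (by positivity)
  -- partial fractions
  have hfrac : 3 / 5 * ((x ^ 2 + 1) / h) - 4 / 5 * ((x ^ 2 + 1) / E)
      = (1 + c) * q * (x ^ 2 + 1) / (h * E) := by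
    have : 3 / 5 * E - 4 / 5 * h = (1 + c) * q := by
      rw [hh_def, hE_def, hq_def]
      ring
    rw [← this]
    field_simp
  rw [hfrac, ← mul_div_assoc, mul_comm h E, ← div_div]
  refine div_le_div_of_nonneg_right ?_ hh.le
  rw [div_le_iff₀ hE]
  have hsum : c * (1 - c) * E = R ^ 2 + (P * (x ^ 2 + 1)) ^ 2 := by
    rw [mul_pow, hP2, hR2, hE_def, hq_def]
    ring
  refine le_of_mul_le_mul_left ?_ (show 0 < c * (1 - c) by positivity)
  calc c * (1 - c) * (2 * P * ((1 + c) * q * (x ^ 2 + 1)))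
      = 2 * R ^ 2 * (P * (x ^ 2 + 1)) := by rw [hR2]; ring
    _ ≤ R * (R ^ 2 + (P * (x ^ 2 + 1)) ^ 2) := by
        nlinarith [mul_nonneg hR0.le (sq_nonneg (R - P * (x ^ 2 + 1)))]
    _ = c * (1 - c) * (R * E) := by rw [← hsum]; ring

lemma integrable_normal_integrand (h0 : 0 < c) (h1 : c < 1) :
    Integrable fun x : ℝ => √(catalecticant (normalMoments c) * quartic (normalMoments c) x 1)
      / hessian (normalMoments c) x 1 := by
  simp only [catalecticant_normalMoments, quartic_normalMoments, hessian_normalMoments]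
  have hc1 : 0 < 1 - c := by linarith
  have hb : 0 < (1 - c) * (1 + 3 * c) := by positivity
  refine Integrable.mono'
    ((integrable_sq_add_one_div h0 hb).const_mul √(c * (1 - c) * (1 + c) * 2)) ?_ ?_
  · refine (Continuous.div (by fun_prop) (by fun_prop) fun x => ?_).aestronglyMeasurable
    exact (sq_sub_one_form_pos h0 hb x).ne'
  · refine Filter.Eventually.of_forall fun x => ?_
    have hh := sq_sub_one_form_pos h0 hb x
    rw [Real.norm_of_nonneg (by positivity), ← mul_div_assoc]
    refine div_le_div_of_nonneg_right ?_ hh.le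
    rw [← Real.sqrt_sq (show 0 ≤ x ^ 2 + 1 by positivity), ← Real.sqrt_mul (by positivity),
      mul_assoc _ 2]
    refine Real.sqrt_le_sqrt (mul_le_mul_of_nonneg_left ?_ (by positivity))
    nlinarith [sq_nonneg (x ^ 2 - 1), sq_nonneg x]

lemma curveLength_normalMoments_lower (h0 : 0 < c) (h1 : c < 1) :
    √(2 / 3) * Real.pi * (12 / 5 - 16 / 5 *
      √(c * (1 - c) * (1 + 3 * c) / ((5 / 3 + 3 * c) * ((1 + 3 * c) * (14 / 3 + 2 * c)))))
      ≤ curveLength (normalMoments c) := by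
  have hc1 : 0 < 1 - c := by linarith
  have hb : 0 < (1 - c) * (1 + 3 * c) := by positivity
  have ha' : 0 < 5 / 3 + 3 * c := by positivity
  have hb' : 0 < (1 + 3 * c) * (14 / 3 + 2 * c) := by positivity
  have hI := integrable_sq_add_one_div h0 hb
  have hI' := integrable_sq_add_one_div ha' hb'
  have hint := integral_mono
    (((hI.const_mul (3 / 5)).sub (hI'.const_mul (4 / 5))).const_mul
      (2 * √(2 / 3 * (c * (1 - c) * (1 + 3 * c)))))
    (integrable_normal_integrand h0 h1) (fun x => normal_integrand_ge h0 h1 x)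
  refine le_trans (le_of_eq ?_) hint
  simp only [Pi.sub_apply]
  rw [integral_const_mul, integral_sub (hI.const_mul _) (hI'.const_mul _), integral_const_mul,
    integral_const_mul, integral_sq_add_one_div h0 hb, integral_sq_add_one_div ha' hb']
  rw [Real.sqrt_mul (by norm_num : (0 : ℝ) ≤ 2 / 3),
    Real.sqrt_div (show 0 ≤ c * (1 - c) * (1 + 3 * c) by positivity),
    ← mul_assoc c (1 - c)]
  have hs1 : 0 < √(c * (1 - c) * (1 + 3 * c)) := Real.sqrt_pos.mpr (by positivity)
  have hs2 : 0 < √((5 / 3 + 3 * c) * ((1 + 3 * c) * (14 / 3 + 2 * c))) :=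
    Real.sqrt_pos.mpr (by positivity)
  generalize √(c * (1 - c) * (1 + 3 * c)) = u at hs1 ⊢
  generalize √((5 / 3 + 3 * c) * ((1 + 3 * c) * (14 / 3 + 2 * c))) = v at hs2 ⊢
  generalize √(2 / 3) = w
  field_simp
  ring

/-- The defect of the lower bound is governed by `70 (3c - 1)²`. -/
lemma curveLength_normalMoments_gt (h0 : 0 < c) (h1 : c < 1) (hc : c ≠ 1 / 3) :
    2 * √(2 / 3) * Real.pi < curveLength (normalMoments c) := by
  refine lt_of_lt_of_le ?_ (curveLength_normalMoments_lower h0 h1)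
  have hc1 : 0 < 1 - c := by linarith
  have hsq : √(c * (1 - c) * (1 + 3 * c) / ((5 / 3 + 3 * c) * ((1 + 3 * c) * (14 / 3 + 2 * c))))
      < 1 / 8 := by
    rw [Real.sqrt_lt' (by norm_num), div_lt_iff₀ (by positivity)]
    have : 0 < (3 * c - 1) ^ 2 := by
      have : 3 * c - 1 ≠ 0 := fun h => hc (by linarith)
      positivity
    nlinarith [mul_pos (show 0 < 1 + 3 * c by positivity) this]
  have : 0 < √(2 / 3) * Real.pi := by positivity
  nlinarith

lemma curveLength_normalMoments_third :
    curveLength (normalMoments (1 / 3)) = 2 * √(2 / 3) * Real.pi := by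
  have : ∀ x : ℝ, √(catalecticant (normalMoments (1 / 3)) * quartic (normalMoments (1 / 3)) x 1)
      / hessian (normalMoments (1 / 3)) x 1 = 2 * √(2 / 3) * (1 + x ^ 2)⁻¹ := by
    intro x
    rw [catalecticant_normalMoments, quartic_normalMoments, hessian_normalMoments]
    rw [show (1 / 3 * (1 - 1 / 3) * (1 + 1 / 3) * ((x ^ 2 - 1) ^ 2 + (2 + 6 * (1 / 3)) * x ^ 2) : ℝ)
      = 2 / 3 * (2 / 3 * (1 + x ^ 2)) ^ 2 by ring, Real.sqrt_mul (by norm_num),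
      Real.sqrt_sq (by positivity)]
    have : 0 < 1 + x ^ 2 := by positivity
    rw [show (1 / 3 * (x ^ 2 - 1) ^ 2 + (1 - 1 / 3) * (1 + 3 * (1 / 3)) * x ^ 2 : ℝ)
      = 1 / 3 * (1 + x ^ 2) ^ 2 by ring]
    field_simp
  rw [curveLength, integral_congr_ae (Filter.Eventually.of_forall this), integral_const_mul,
    integral_univ_inv_one_add_sq]

end NormalForm

/-! ### Invariance of the length integral under Möbius transformations -/

lemma ae_affine_ne_zero {c d : ℝ} (h : c ≠ 0 ∨ d ≠ 0) : ∀ᵐ x : ℝ, c * x + d ≠ 0 := by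
  have hsub : {x : ℝ | ¬ (c * x + d ≠ 0)}.Subsingleton := by
    intro x hx y hy
    simp only [ne_eq, not_not, Set.mem_ofPred_eq] at hx hy
    rcases eq_or_ne c 0 with hc | hc
    · simp_all
    · exact mul_left_cancel₀ hc (by linarith)
  exact hsub.measure_zero volume

/-- The Möbius transformation `x ↦ (ax + b) / (cx + d)` as a change of variables on the real line;
the poles form a null set. -/
lemma integral_comp_mobius {a b c d : ℝ} (hg : a * d - b * c ≠ 0) (F : ℝ → ℝ) :
    ∫ y, F y = ∫ x, |a * d - b * c| / (c * x + d) ^ 2 * F ((a * x + b) / (c * x + d)) := by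
  have hcd : c ≠ 0 ∨ d ≠ 0 := by
    by_contra! h
    simp [h] at hg
  have hca : -c ≠ 0 ∨ a ≠ 0 := by
    by_contra! h
    rw [neg_eq_zero] at h
    simp [h] at hg
  set S := {x : ℝ | c * x + d ≠ 0} with hS
  have hSm : MeasurableSet S := (measurableSet_eq_fun (by fun_prop) (by fun_prop)).compl
  have hderiv : ∀ x ∈ S, HasDerivWithinAt (fun x => (a * x + b) / (c * x + d))
      ((a * d - b * c) / (c * x + d) ^ 2) S x := by
    intro x hx
    have h1 : HasDerivAt (fun x : ℝ => a * x + b) a x := by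
      simpa using ((hasDerivAt_id x).const_mul a).add_const b
    have h2 : HasDerivAt (fun x : ℝ => c * x + d) c x := by
      simpa using ((hasDerivAt_id x).const_mul c).add_const d
    refine ((h1.div h2 hx).congr_deriv ?_).hasDerivWithinAt
    congr 1
    ring
  have hinj : Set.InjOn (fun x => (a * x + b) / (c * x + d)) S := by
    intro x hx y hy hxy
    simp only [hS, Set.mem_ofPred_eq] at hx hy
    simp only at hxy
    rw [div_eq_div_iff hx hy] at hxy
    exact mul_left_cancel₀ hg (by linear_combination hxy)
  have himage : (fun x => (a * x + b) / (c * x + d)) '' S = {y : ℝ | -c * y + a ≠ 0} := by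
    ext y
    simp only [Set.mem_image, Set.mem_ofPred_eq, hS]
    constructor
    · rintro ⟨x, hx, rfl⟩
      have : -c * ((a * x + b) / (c * x + d)) + a = (a * d - b * c) / (c * x + d) := by
        field_simp
        ring
      rw [this]
      exact div_ne_zero hg hx
    · intro hy
      have e : c * ((d * y - b) / (-c * y + a)) + d = (a * d - b * c) / (-c * y + a) := by
        rw [eq_div_iff hy, add_mul, mul_assoc, div_mul_cancel₀ _ hy]
        ring
      refine ⟨(d * y - b) / (-c * y + a), ?_, ?_⟩
      · rw [e]
        exact div_ne_zero hg hy
      · rw [e, div_div_eq_mul_div, div_eq_iff hg, add_mul, mul_assoc, div_mul_cancel₀ _ hy]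
        ring
  have key := integral_image_eq_integral_abs_deriv_smul hSm hderiv hinj F
  rw [himage] at key
  have e1 : ({y : ℝ | -c * y + a ≠ 0} : Set ℝ) =ᵐ[volume] Set.univ :=
    Filter.eventuallyEq_univ.mpr (ae_affine_ne_zero hca)
  have e2 : S =ᵐ[volume] Set.univ := Filter.eventuallyEq_univ.mpr (ae_affine_ne_zero hcd)
  rw [setIntegral_congr_set e1, setIntegral_congr_set e2, setIntegral_univ, setIntegral_univ] at key
  rw [key]
  simp only [smul_eq_mul, abs_div, abs_pow, sq_abs]

lemma quartic_div (m : Fin 5 → ℝ) (X : ℝ) {Y : ℝ} (hY : Y ≠ 0) :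
    quartic m (X / Y) 1 = quartic m X Y / Y ^ 4 := by
  simp only [quartic]
  field_simp

lemma hessian_div (m : Fin 5 → ℝ) (X : ℝ) {Y : ℝ} (hY : Y ≠ 0) :
    hessian m (X / Y) 1 = hessian m X Y / Y ^ 4 := by
  simp only [hessian]
  field_simp

/-- The length integral is an invariant of the quartic form under `GL₂(ℝ)`: the weights of the
catalecticant (six) and of the Hessian (two) compensate the Jacobian. -/
lemma curveLength_changeVar {a b c d : ℝ} (hg : a * d - b * c ≠ 0) (m : Fin 5 → ℝ) :
    curveLength (changeVar a b c d m) = curveLength m := by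
  have hcd : c ≠ 0 ∨ d ≠ 0 := by
    by_contra! h
    simp [h] at hg
  rw [curveLength, curveLength, integral_comp_mobius hg
    fun x => √(catalecticant m * quartic m x 1) / hessian m x 1]
  refine integral_congr_ae ?_
  filter_upwards [ae_affine_ne_zero hcd] with x hx
  rw [catalecticant_changeVar, quartic_changeVar, hessian_changeVar, quartic_div _ _ hx,
    hessian_div _ _ hx, mul_one, mul_one]
  generalize quartic m (a * x + b) (c * x + d) = q
  generalize hessian m (a * x + b) (c * x + d) = h
  have hD : 0 < |a * d - b * c| := abs_pos.mpr hg
  rw [show (a * d - b * c) ^ 6 * catalecticant m * q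
      = (|a * d - b * c| ^ 3) ^ 2 * (catalecticant m * q) by
        rw [← pow_mul, Even.pow_abs (by decide)]
        ring, show catalecticant m * (q / (c * x + d) ^ 4)
      = catalecticant m * q / ((c * x + d) ^ 2) ^ 2 by ring,
    Real.sqrt_mul (by positivity), Real.sqrt_div' _ (by positivity),
    Real.sqrt_sq (by positivity), Real.sqrt_sq (by positivity), ← sq_abs (a * d - b * c)]
  field_simp

/-! ### The minimum of the length integral -/

/-- The squared Euclidean norm of `(aX + bY, cX + dY)`. -/
def gNormSq (g : GL (Fin 2) ℝ) (X Y : ℝ) : ℝ :=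
  (g 0 0 * X + g 0 1 * Y) ^ 2 + (g 1 0 * X + g 1 1 * Y) ^ 2

/-- The quartic form of `m` is a positive multiple of the square of the norm `|g ·|²`. -/
def IsNormSquare (g : GL (Fin 2) ℝ) (m : Fin 5 → ℝ) : Prop :=
  ∃ κ : ℝ, 0 < κ ∧ ∀ X Y, quartic m X Y = κ * gNormSq g X Y ^ 2

lemma det_entries_ne_zero (g : GL (Fin 2) ℝ) : g 0 0 * g 1 1 - g 0 1 * g 1 0 ≠ 0 := by
  have := g.det_ne_zero
  rwa [Matrix.det_fin_two] at this

/-- The invertible matrix with the given entries. -/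
noncomputable def mkGL (a b c d : ℝ) (h : a * d - b * c ≠ 0) : GL (Fin 2) ℝ :=
  Matrix.GeneralLinearGroup.mkOfDetNeZero !![a, b; c, d] (by simpa [Matrix.det_fin_two] using h)

@[simp] lemma mkGL_00 {a b c d : ℝ} (h : a * d - b * c ≠ 0) : mkGL a b c d h 0 0 = a := rfl
@[simp] lemma mkGL_01 {a b c d : ℝ} (h : a * d - b * c ≠ 0) : mkGL a b c d h 0 1 = b := rfl
@[simp] lemma mkGL_10 {a b c d : ℝ} (h : a * d - b * c ≠ 0) : mkGL a b c d h 1 0 = c := rfl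
@[simp] lemma mkGL_11 {a b c d : ℝ} (h : a * d - b * c ≠ 0) : mkGL a b c d h 1 1 = d := rfl

lemma exists_isNormSquare_of_changeVar {a b c d : ℝ} (hg : a * d - b * c ≠ 0) {m : Fin 5 → ℝ}
    (h : changeVar a b c d m = normalMoments (1 / 3)) : ∃ g, IsNormSquare g m := by
  refine ⟨mkGL d (-b) (-c) a (by convert hg using 1; ring), ((a * d - b * c) ^ 4)⁻¹,
    by positivity, fun X Y => ?_⟩
  have h1 := quartic_changeVar a b c d m (d * X - b * Y) (-c * X + a * Y)
  rw [h, show a * (d * X - b * Y) + b * (-c * X + a * Y) = (a * d - b * c) * X by ring,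
    show c * (d * X - b * Y) + d * (-c * X + a * Y) = (a * d - b * c) * Y by ring] at h1
  have h2 : quartic m ((a * d - b * c) * X) ((a * d - b * c) * Y)
      = (a * d - b * c) ^ 4 * quartic m X Y := by
    simp only [quartic]
    ring
  rw [h2] at h1
  rw [eq_inv_mul_iff_mul_eq₀ (pow_ne_zero 4 hg), ← h1]
  simp [quartic, normalMoments, gNormSq]
  ring

lemma curveLength_ge {m : Fin 5 → ℝ} (hm : (hankel m).PosDef) :
    2 * √(2 / 3) * Real.pi ≤ curveLength m := by
  obtain ⟨a, b, c, d, κ, hg, h0, h1, h⟩ := exists_normalMoments hm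
  rw [← curveLength_changeVar hg, h]
  rcases eq_or_ne κ (1 / 3) with rfl | hκ
  · exact curveLength_normalMoments_third.ge
  · exact (curveLength_normalMoments_gt h0 h1 hκ).le

lemma exists_isNormSquare_of_curveLength_le {m : Fin 5 → ℝ} (hm : (hankel m).PosDef)
    (hle : curveLength m ≤ 2 * √(2 / 3) * Real.pi) : ∃ g, IsNormSquare g m := by
  obtain ⟨a, b, c, d, κ, hg, h0, h1, h⟩ := exists_normalMoments hm
  rw [← curveLength_changeVar hg, h] at hle
  rcases eq_or_ne κ (1 / 3) with rfl | hκ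
  · exact exists_isNormSquare_of_changeVar hg h
  · exact absurd hle (curveLength_normalMoments_gt h0 h1 hκ).not_ge

/-- The moment sequences whose quartic form is `κ |g ·|⁴` form the `GL₂(ℝ)`-orbit of the
rotation-invariant one. -/
lemma IsNormSquare.exists_eq_changeVar {g : GL (Fin 2) ℝ} {m : Fin 5 → ℝ} (h : IsNormSquare g m) :
    ∃ a b c d : ℝ, a * d - b * c ≠ 0 ∧ m = changeVar a b c d (normalMoments (1 / 3)) := by
  obtain ⟨κ, hκ, hm⟩ := h
  obtain ⟨s, hs, hs1⟩ := exists_pow_four_mul_eq_one (r := κ⁻¹) (by positivity)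
  have hs2 : s ^ 4 = κ := by
    rwa [inv_mul_eq_one₀ hκ.ne', eq_comm] at hs1
  refine ⟨s * g 0 0, s * g 0 1, s * g 1 0, s * g 1 1, ?_, quartic_injective fun X Y => ?_⟩
  · rw [show s * g 0 0 * (s * g 1 1) - s * g 0 1 * (s * g 1 0)
      = s ^ 2 * (g 0 0 * g 1 1 - g 0 1 * g 1 0) by ring]
    exact mul_ne_zero (by positivity) (det_entries_ne_zero g)
  · rw [quartic_changeVar, hm, ← hs2]
    simp [quartic, normalMoments, gNormSq]
    ring

lemma IsNormSquare.curveLength_eq {g : GL (Fin 2) ℝ} {m : Fin 5 → ℝ} (h : IsNormSquare g m) :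
    curveLength m = 2 * √(2 / 3) * Real.pi := by
  obtain ⟨a, b, c, d, hdet, rfl⟩ := h.exists_eq_changeVar
  rw [curveLength_changeVar hdet, curveLength_normalMoments_third]

lemma IsNormSquare.posDef {g : GL (Fin 2) ℝ} {m : Fin 5 → ℝ} (h : IsNormSquare g m) :
    (hankel m).PosDef := by
  obtain ⟨a, b, c, d, hdet, rfl⟩ := h.exists_eq_changeVar
  refine hankel_changeVar_posDef hdet ((hankel_posDef_iff _).mpr fun x y z hxyz => ?_)
  simp only [normalMoments]
  have e : ![1, 0, 1 / 3, 0, 1] 0 * x ^ 2 + 2 * ![1, 0, 1 / 3, 0, 1] 1 * x * y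
      + ![1, 0, 1 / 3, 0, 1] 2 * (y ^ 2 + 2 * x * z) + 2 * ![1, 0, 1 / 3, 0, 1] 3 * y * z
      + ![1, 0, 1 / 3, 0, 1] 4 * z ^ 2
      = (1 / 3) * (x + z) ^ 2 + 2 / 3 * x ^ 2 + 1 / 3 * y ^ 2 + 2 / 3 * z ^ 2 := by
    simp
    ring
  rw [e]
  rcases hxyz with h | h | h <;> positivity

/-! ### The tube volume as a length integral -/

section NormalizedCurve

variable {E : Type*} [NormedAddCommGroup E] [InnerProductSpace ℝ E]

/-- The speed of the radial projection to the unit sphere of a curve avoiding the origin. -/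
lemma norm_deriv_normalize {v : ℝ → E} {v' : E} {x : ℝ} (hv : HasDerivAt v v' x) (h0 : v x ≠ 0) :
    ‖deriv (fun y => ‖v y‖⁻¹ • v y) x‖
      = √(‖v x‖ ^ 2 * ‖v'‖ ^ 2 - inner ℝ (v x) v' ^ 2) / ‖v x‖ ^ 2 := by
  have hn : 0 < ‖v x‖ := norm_pos_iff.mpr h0
  have hnorm : HasDerivAt (fun y => ‖v y‖) (inner ℝ (v x) v' / ‖v x‖) x := by
    have h1 := hv.norm_sq.sqrt (by positivity)
    simp only [Real.sqrt_sq (norm_nonneg _)] at h1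
    refine h1.congr_deriv ?_
    field_simp
  have hd := (hnorm.inv hn.ne').smul hv
  have hd' : HasDerivAt (fun y => ‖v y‖⁻¹ • v y)
      (‖v x‖⁻¹ • v' + (-(inner ℝ (v x) v' / ‖v x‖) / ‖v x‖ ^ 2) • v x) x := hd
  rw [hd'.deriv]
  set w := ‖v x‖⁻¹ • v' + (-(inner ℝ (v x) v' / ‖v x‖) / ‖v x‖ ^ 2) • v x with hw
  rw [eq_div_iff (by positivity), ← Real.sqrt_sq (show 0 ≤ ‖w‖ * ‖v x‖ ^ 2 by positivity)]
  congr 1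
  rw [mul_pow, hw, norm_add_sq_real, norm_smul, norm_smul, inner_smul_left, inner_smul_right,
    real_inner_comm (v x) v']
  simp only [Real.norm_eq_abs, mul_pow, sq_abs, RCLike.conj_to_real]
  field_simp
  ring

end NormalizedCurve

lemma hasDerivAt_polyBasis_three (x : ℝ) :
    HasDerivAt (polyBasis 3) ![0, 1, 2 * x] x := by
  rw [hasDerivAt_pi]
  intro i
  fin_cases i
  · simpa [polyBasis] using hasDerivAt_const x (1 : ℝ)
  · simpa [polyBasis] using hasDerivAt_id' x
  · simpa [polyBasis] using hasDerivAt_pow 2 x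

lemma inner_sqrt_mulVec {n : ℕ} {S : Matrix (Fin n) (Fin n) ℝ} (hS : S.PosSemidef)
    (u v : Fin n → ℝ) :
    inner ℝ (WithLp.toLp 2 (CFC.sqrt S *ᵥ u)) (WithLp.toLp 2 (CFC.sqrt S *ᵥ v))
      = u ⬝ᵥ (S *ᵥ v) := by
  have h0 : 0 ≤ S := Matrix.nonneg_iff_posSemidef.mpr hS
  have hsq : CFC.sqrt S * CFC.sqrt S = S := CFC.sqrt_mul_sqrt_self S h0
  have hT : (CFC.sqrt S)ᵀ = CFC.sqrt S := by
    have := (Matrix.nonneg_iff_posSemidef.mp (CFC.sqrt_nonneg S)).1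
    simpa [Matrix.IsHermitian] using this
  rw [EuclideanSpace.inner_toLp_toLp, star_trivial, dotProduct_comm, Matrix.dotProduct_mulVec,
    ← Matrix.mulVec_transpose, hT, Matrix.mulVec_mulVec, hsq, dotProduct_comm,
    Matrix.dotProduct_mulVec, ← Matrix.mulVec_transpose]
  have hST : Sᵀ = S := by simpa [Matrix.IsHermitian] using hS.1
  rw [hST, dotProduct_comm]

/-- The bilinear form of the adjugate of `hankel m`. -/
def adjForm (m : Fin 5 → ℝ) (u v : Fin 3 → ℝ) : ℝ :=
  (m 2 * m 4 - m 3 ^ 2) * u 0 * v 0 + (m 2 * m 3 - m 1 * m 4) * (u 0 * v 1 + u 1 * v 0)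
    + (m 1 * m 3 - m 2 ^ 2) * (u 0 * v 2 + u 2 * v 0) + (m 0 * m 4 - m 2 ^ 2) * u 1 * v 1
    + (m 1 * m 2 - m 0 * m 3) * (u 1 * v 2 + u 2 * v 1) + (m 0 * m 2 - m 1 ^ 2) * u 2 * v 2

lemma dotProduct_hankel_inv {m : Fin 5 → ℝ} (u v : Fin 3 → ℝ) :
    u ⬝ᵥ ((hankel m)⁻¹ *ᵥ v) = adjForm m u v / catalecticant m := by
  rw [Matrix.inv_def, hankel_det, Ring.inverse_eq_inv', Matrix.smul_mulVec, dotProduct_smul,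
    smul_eq_mul, div_eq_inv_mul]
  congr 1
  simp [hankel, Matrix.adjugate_fin_three_of, Matrix.mulVec, dotProduct, Fin.sum_univ_three,
    adjForm]
  ring

/-- The Gram determinant of the basis curve `f` and its derivative with respect to `(hankel m)⁻¹` is
the quartic form of `m` divided by `det (hankel m)`, since `f × f' = (x², -2x, 1)`. -/
lemma tubeVolume_hankel_inv {m : Fin 5 → ℝ} (hm : (hankel m).PosDef) :
    tubeVolume 3 (hankel m)⁻¹ = 2 * curveLength m := by
  have hS := hm.inv.posSemidef
  have hJ := catalecticant_pos hm
  rw [tubeVolume, curveLength]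
  congr 1
  refine integral_congr_ae (Filter.Eventually.of_forall fun x => ?_)
  simp only
  set L := CFC.sqrt (hankel m)⁻¹ with hL
  have hv : HasDerivAt (fun y => WithLp.toLp 2 (L *ᵥ polyBasis 3 y))
      (WithLp.toLp 2 (L *ᵥ ![0, 1, 2 * x])) x := by
    have := (((PiLp.continuousLinearEquiv 2 ℝ (fun _ : Fin 3 => ℝ)).symm :
      (Fin 3 → ℝ) →L[ℝ] PiLp 2 (fun _ : Fin 3 => ℝ)).comp
        (Matrix.mulVecLin L).toContinuousLinearMap).hasFDerivAt.comp_hasDerivAt x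
          (hasDerivAt_polyBasis_three x)
    exact this
  have hf : polyBasis 3 x = ![1, x, x ^ 2] := by
    ext i
    fin_cases i <;> simp [polyBasis]
  have hnv : ‖WithLp.toLp 2 (L *ᵥ polyBasis 3 x)‖ ^ 2 = hessian m x 1 / catalecticant m := by
    rw [← real_inner_self_eq_norm_sq, inner_sqrt_mulVec hS, dotProduct_hankel_inv, hf]
    congr 1
    simp [adjForm, hessian]
    ring
  have hnv' : ‖WithLp.toLp 2 (L *ᵥ ![0, 1, 2 * x])‖ ^ 2
      = adjForm m ![0, 1, 2 * x] ![0, 1, 2 * x] / catalecticant m := by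
    rw [← real_inner_self_eq_norm_sq, inner_sqrt_mulVec hS, dotProduct_hankel_inv]
  have hin : inner ℝ (WithLp.toLp 2 (L *ᵥ polyBasis 3 x)) (WithLp.toLp 2 (L *ᵥ ![0, 1, 2 * x]))
      = adjForm m ![1, x, x ^ 2] ![0, 1, 2 * x] / catalecticant m := by
    rw [inner_sqrt_mulVec hS, dotProduct_hankel_inv, hf]
  have hne : WithLp.toLp 2 (L *ᵥ polyBasis 3 x) ≠ 0 := by
    intro h0
    have hpos := hm.inv.dotProduct_mulVec_pos (x := polyBasis 3 x) (by
      intro h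
      have := congrFun h 0
      simp [polyBasis] at this)
    rw [star_trivial, ← inner_sqrt_mulVec hS, ← hL, h0] at hpos
    simp at hpos
  have hh : 0 < hessian m x 1 := by
    have : 0 < hessian m x 1 / catalecticant m := by
      rw [← hnv]
      have := norm_pos_iff.mpr hne
      positivity
    exact (div_pos_iff_of_pos_right hJ).mp this
  have hfun : normalizedBasis 3 (hankel m)⁻¹ = fun y => ‖WithLp.toLp 2 (L *ᵥ polyBasis 3 y)‖⁻¹ •
      WithLp.toLp 2 (L *ᵥ polyBasis 3 y) := rfl
  rw [hfun, norm_deriv_normalize hv hne, hnv, hnv', hin]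
  have hgram : hessian m x 1 / catalecticant m
        * (adjForm m ![0, 1, 2 * x] ![0, 1, 2 * x] / catalecticant m)
      - (adjForm m ![1, x, x ^ 2] ![0, 1, 2 * x] / catalecticant m) ^ 2
      = catalecticant m * quartic m x 1 / catalecticant m ^ 2 := by
    have : hessian m x 1 * adjForm m ![0, 1, 2 * x] ![0, 1, 2 * x]
        - adjForm m ![1, x, x ^ 2] ![0, 1, 2 * x] ^ 2 = catalecticant m * quartic m x 1 := by
      simp [hessian, adjForm, catalecticant, quartic]
      ring
    rw [← this]
    field_simp
  rw [hgram, Real.sqrt_div' _ (by positivity), Real.sqrt_sq hJ.le]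
  field_simp

/-! ### Homogeneous coordinates on the extended line -/

/-- The first homogeneous coordinate, with `x ↦ [x : 1]` and `∞ ↦ [1 : 0]`. -/
def coordX : OnePoint ℝ → ℝ
  | ∞ => 1
  | OnePoint.some x => x

/-- The second homogeneous coordinate, with `x ↦ [x : 1]` and `∞ ↦ [1 : 0]`. -/
def coordY : OnePoint ℝ → ℝ
  | ∞ => 0
  | OnePoint.some _ => 1

@[simp] lemma coordX_coe (x : ℝ) : coordX (x : OnePoint ℝ) = x := rfl
@[simp] lemma coordY_coe (x : ℝ) : coordY (x : OnePoint ℝ) = 1 := rfl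
@[simp] lemma coordX_infty : coordX ∞ = 1 := rfl
@[simp] lemma coordY_infty : coordY ∞ = 0 := rfl

/-- The first coordinate of `g (X, Y)` for the homogeneous coordinates `(X, Y)` of `x`. -/
def imX (g : GL (Fin 2) ℝ) (x : OnePoint ℝ) : ℝ := g 0 0 * coordX x + g 0 1 * coordY x

/-- The second coordinate of `g (X, Y)` for the homogeneous coordinates `(X, Y)` of `x`. -/
def imY (g : GL (Fin 2) ℝ) (x : OnePoint ℝ) : ℝ := g 1 0 * coordX x + g 1 1 * coordY x

lemma coord_ne_zero (x : OnePoint ℝ) : ¬ (coordX x = 0 ∧ coordY x = 0) := by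
  induction x using OnePoint.rec <;> simp

lemma im_ne_zero (g : GL (Fin 2) ℝ) (x : OnePoint ℝ) : ¬ (imX g x = 0 ∧ imY g x = 0) := by
  rintro ⟨h1, h2⟩
  have hD := det_entries_ne_zero g
  simp only [imX, imY] at h1 h2
  refine coord_ne_zero x ⟨mul_left_cancel₀ hD ?_, mul_left_cancel₀ hD ?_⟩
  · linear_combination g 1 1 * h1 - g 0 1 * h2
  · linear_combination g 0 0 * h2 - g 1 0 * h1

lemma smul_eq_coe_iff (g : GL (Fin 2) ℝ) (x : OnePoint ℝ) (y : ℝ) :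
    g • x = (y : OnePoint ℝ) ↔ imX g x = y * imY g x := by
  have hne := im_ne_zero g x
  induction x using OnePoint.rec with
  | infty =>
    simp only [imX, imY, coordX_infty, coordY_infty, mul_one, mul_zero, add_zero] at hne ⊢
    rw [OnePoint.smul_infty_eq_ite]
    split_ifs with h
    · simp only [OnePoint.infty_ne_coe, false_iff]
      intro h'
      exact hne ⟨by rw [h', h, mul_zero], h⟩
    · rw [OnePoint.coe_eq_coe, div_eq_iff h]
  | coe x =>
    simp only [imX, imY, coordX_coe, coordY_coe, mul_one] at hne ⊢
    rw [OnePoint.smul_some_eq_ite]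
    split_ifs with h
    · simp only [OnePoint.infty_ne_coe, false_iff]
      intro h'
      exact hne ⟨by rw [h', h, mul_zero], h⟩
    · rw [OnePoint.coe_eq_coe, div_eq_iff h]

lemma polyVarExt_eq (g : GL (Fin 2) ℝ) (x : OnePoint ℝ) :
    polyVarExt 3 g x = (imX g x ^ 2 + imY g x ^ 2) ^ 2 := by
  induction x using OnePoint.rec with
  | infty => simp [polyVarExt, imX, imY]
  | coe x =>
    simp [polyVarExt, polyVar, imX, imY]
    ring

lemma polyVarExt_pos (g : GL (Fin 2) ℝ) (x : OnePoint ℝ) : 0 < polyVarExt 3 g x := by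
  rw [polyVarExt_eq]
  have : 0 < imX g x ^ 2 + imY g x ^ 2 := by
    rcases not_and_or.mp (im_ne_zero g x) with h | h <;> positivity
  positivity

/-! ### Moments of designs -/

/-- The moment sequence of the discrete measure with weights `p_i / σ_P²(x_i; g₀)`. -/
noncomputable def designMoments (g₀ : GL (Fin 2) ℝ) (ξ : OnePoint ℝ →₀ ℝ) (k : Fin 5) : ℝ :=
  ξ.sum fun x p => p / polyVarExt 3 g₀ x * (coordX x ^ (k : ℕ) * coordY x ^ (4 - (k : ℕ)))

/-- The moment sequence of the measure `σ_P²(x; g₀)⁻¹ dρ(x)`. -/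
noncomputable def infoMoments (g₀ : GL (Fin 2) ℝ) (ρ : Measure ℝ) (k : Fin 5) : ℝ :=
  ∫ x, x ^ (k : ℕ) / polyVar 3 g₀ x ∂ρ

lemma polyBasisExt_three (x : OnePoint ℝ) :
    polyBasisExt 3 x = ![coordY x ^ 2, coordX x * coordY x, coordX x ^ 2] := by
  induction x using OnePoint.rec with
  | infty => ext i; fin_cases i <;> simp [polyBasisExt]
  | coe x => ext i; fin_cases i <;> simp [polyBasisExt, polyBasis]

lemma designMatrix_eq (g₀ : GL (Fin 2) ℝ) (ξ : OnePoint ℝ →₀ ℝ) :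
    designMatrix 3 g₀ ξ = hankel (designMoments g₀ ξ) := by
  ext i j
  rw [designMatrix, Finsupp.sum, Matrix.sum_apply]
  fin_cases i <;> fin_cases j <;>
    simp [hankel, designMoments, Finsupp.sum, polyBasisExt_three] <;>
    refine Finset.sum_congr rfl fun x _ => ?_ <;> ring

lemma infoMatrix_eq (g₀ : GL (Fin 2) ℝ) (ρ : Measure ℝ) :
    infoMatrix 3 g₀ ρ = hankel (infoMoments g₀ ρ) := by
  ext i j
  fin_cases i <;> fin_cases j <;>
    simp [hankel, infoMoments, infoMatrix, polyBasis] <;>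
    refine integral_congr_ae (Filter.Eventually.of_forall fun x => ?_) <;> ring

lemma quartic_designMoments (g₀ : GL (Fin 2) ℝ) (ξ : OnePoint ℝ →₀ ℝ) (X Y : ℝ) :
    quartic (designMoments g₀ ξ) X Y
      = ξ.sum fun x p => p / polyVarExt 3 g₀ x * (X * coordY x - Y * coordX x) ^ 4 := by
  simp only [quartic, designMoments, Finsupp.sum, Finset.mul_sum, Finset.sum_mul,
    ← Finset.sum_add_distrib, ← Finset.sum_sub_distrib]
  refine Finset.sum_congr rfl fun x _ => ?_
  norm_num
  ring

lemma quartic_designMoments_sum_single (g₀ : GL (Fin 2) ℝ) (x : Fin 3 → OnePoint ℝ)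
    (p : Fin 3 → ℝ) (X Y : ℝ) :
    quartic (designMoments g₀ (∑ i, Finsupp.single (x i) (p i))) X Y
      = ∑ i, p i / polyVarExt 3 g₀ (x i) * (X * coordY (x i) - Y * coordX (x i)) ^ 4 := by
  rw [quartic_designMoments, ← Finsupp.sum_finsetSum_index (by simp)
    (by intros; ring)]
  refine Finset.sum_congr rfl fun i _ => ?_
  rw [Finsupp.sum_single_index (by simp)]

lemma designMoments_sum_single (g₀ : GL (Fin 2) ℝ) (x : Fin 3 → OnePoint ℝ)
    (p : Fin 3 → ℝ) (k : Fin 5) :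
    designMoments g₀ (∑ i, Finsupp.single (x i) (p i)) k
      = ∑ i, p i / polyVarExt 3 g₀ (x i)
        * (coordX (x i) ^ (k : ℕ) * coordY (x i) ^ (4 - (k : ℕ))) := by
  rw [designMoments, ← Finsupp.sum_finsetSum_index (by simp) (by intros; ring)]
  refine Finset.sum_congr rfl fun i _ => ?_
  rw [Finsupp.sum_single_index (by simp)]

/-! ### The Möbius family of three-point designs -/

/-- The numbers `tan (π t⁰_i)` for three points. -/
noncomputable def tanPoint : Fin 3 → ℝ := ![-√3, 0, √3]

lemma tan_uniformPoint (i : Fin 3) : Real.tan (Real.pi * uniformPoint 3 i) = tanPoint i := by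
  fin_cases i
  · have : Real.pi * uniformPoint 3 0 = -(Real.pi / 3) := by
      simp [uniformPoint]
      ring
    simp [this, tanPoint]
  · have : Real.pi * uniformPoint 3 1 = 0 := by
      simp [uniformPoint]
      norm_num
    simp [this, tanPoint]
  · have : Real.pi * uniformPoint 3 2 = Real.pi / 3 := by
      simp [uniformPoint]
      ring
    simp [this, tanPoint]

lemma tanPoint_injective : Function.Injective tanPoint := by
  have h3 : 0 < √(3 : ℝ) := by positivity
  intro i j hij
  fin_cases i <;> fin_cases j <;> simp [tanPoint] at hij ⊢ <;> linarith

lemma designPoint_eq_iff (g : GL (Fin 2) ℝ) (i : Fin 3) (x : OnePoint ℝ) :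
    designPoint 3 g i = x ↔ imX g x = tanPoint i * imY g x := by
  rw [designPoint, tan_uniformPoint, inv_smul_eq_iff, eq_comm, smul_eq_coe_iff]

lemma imX_designPoint (g : GL (Fin 2) ℝ) (i : Fin 3) :
    imX g (designPoint 3 g i) = tanPoint i * imY g (designPoint 3 g i) :=
  (designPoint_eq_iff g i _).mp rfl

lemma imY_designPoint_ne_zero (g : GL (Fin 2) ℝ) (i : Fin 3) :
    imY g (designPoint 3 g i) ≠ 0 := by
  intro h
  exact im_ne_zero g _ ⟨by rw [imX_designPoint, h, mul_zero], h⟩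

lemma designPoint_injective (g : GL (Fin 2) ℝ) : Function.Injective (designPoint 3 g) := by
  intro i j hij
  have h1 := imX_designPoint g i
  rw [hij, imX_designPoint g j] at h1
  exact (tanPoint_injective (mul_right_cancel₀ (imY_designPoint_ne_zero g j) h1)).symm

lemma designRatio_pos (g₀ g : GL (Fin 2) ℝ) (i : Fin 3) : 0 < designRatio 3 g₀ g i :=
  div_pos (polyVarExt_pos _ _) (polyVarExt_pos _ _)

lemma sum_designRatio_pos (g₀ g : GL (Fin 2) ℝ) : 0 < ∑ j, designRatio 3 g₀ g j :=
  Finset.sum_pos (fun i _ => designRatio_pos g₀ g i) Finset.univ_nonempty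

lemma isPointDesign_sum_single {n : ℕ} {x : Fin n → OnePoint ℝ} (hx : Function.Injective x)
    {p : Fin n → ℝ} (hp : ∀ i, 0 < p i) (hsum : ∑ i, p i = 1) :
    IsPointDesign n (∑ i, Finsupp.single (x i) (p i)) := by
  classical
  have hval : ∀ i, (∑ j, Finsupp.single (x j) (p j)) (x i) = p i := by
    intro i
    rw [Finsupp.finsetSum_apply, Finset.sum_eq_single i]
    · simp
    · intro j _ hj
      exact Finsupp.single_eq_of_ne (fun h => hj (hx h).symm)
    · simp
  have hval0 : ∀ y, y ∉ Set.range x → (∑ j, Finsupp.single (x j) (p j)) y = 0 := by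
    intro y hy
    rw [Finsupp.finsetSum_apply]
    exact Finset.sum_eq_zero fun j _ => Finsupp.single_eq_of_ne (fun h => hy ⟨j, h.symm⟩)
  have hsupp : (∑ j, Finsupp.single (x j) (p j)).support = Finset.univ.image x := by
    ext y
    rw [Finsupp.mem_support_iff]
    by_cases hy : y ∈ Set.range x
    · obtain ⟨i, rfl⟩ := hy
      simp [hval, (hp i).ne']
    · simp only [hval0 y hy, ne_eq, not_true_eq_false, false_iff]
      simpa using hy
  refine ⟨fun y => ?_, ?_, ?_⟩
  · by_cases hy : y ∈ Set.range x
    · obtain ⟨i, rfl⟩ := hy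
      rw [hval]
      exact (hp i).le
    · rw [hval0 y hy]
  · rw [Finsupp.sum, hsupp, Finset.sum_image fun i _ j _ h => hx h]
    simp only [hval, hsum]
  · rw [hsupp, Finset.card_image_of_injective _ hx, Finset.card_univ, Fintype.card_fin]

lemma mobiusDesign_isPointDesign (g₀ g : GL (Fin 2) ℝ) :
    IsPointDesign 3 (mobiusDesign 3 g₀ g) := by
  refine isPointDesign_sum_single (designPoint_injective g)
    (fun i => div_pos (designRatio_pos g₀ g i) (sum_designRatio_pos g₀ g)) ?_
  rw [← Finset.sum_div, div_self (sum_designRatio_pos g₀ g).ne']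

/-- The quartic form of a Möbius design is a multiple of `|g ·|⁴`, by the identity
`16 A⁴ + (A + √3 B)⁴ + (A - √3 B)⁴ = 18 (A² + B²)²`. -/
lemma mobiusDesign_isNormSquare (g₀ g : GL (Fin 2) ℝ) :
    IsNormSquare g (designMoments g₀ (mobiusDesign 3 g₀ g)) := by
  have hD := det_entries_ne_zero g
  have hR := sum_designRatio_pos g₀ g
  refine ⟨9 / 8 / ((g 0 0 * g 1 1 - g 0 1 * g 1 0) ^ 4 * ∑ j, designRatio 3 g₀ g j),
    by positivity, fun X Y => ?_⟩
  rw [mobiusDesign, quartic_designMoments_sum_single]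
  set A := g 0 0 * X + g 0 1 * Y with hA
  set B := g 1 0 * X + g 1 1 * Y with hB
  have hterm : ∀ i, designRatio 3 g₀ g i / (∑ j, designRatio 3 g₀ g j)
        / polyVarExt 3 g₀ (designPoint 3 g i)
        * (X * coordY (designPoint 3 g i) - Y * coordX (designPoint 3 g i)) ^ 4
      = (A - B * tanPoint i) ^ 4 / (tanPoint i ^ 2 + 1) ^ 2
        / ((g 0 0 * g 1 1 - g 0 1 * g 1 0) ^ 4 * ∑ j, designRatio 3 g₀ g j) := by
    intro i
    have hx := imX_designPoint g i
    have hy := imY_designPoint_ne_zero g i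
    have h0 := polyVarExt_pos g₀ (designPoint 3 g i)
    have hg : polyVarExt 3 g (designPoint 3 g i)
        = imY g (designPoint 3 g i) ^ 4 * (tanPoint i ^ 2 + 1) ^ 2 := by
      rw [polyVarExt_eq, hx]
      ring
    have hw : (g 0 0 * g 1 1 - g 0 1 * g 1 0)
          * (X * coordY (designPoint 3 g i) - Y * coordX (designPoint 3 g i))
        = (A - B * tanPoint i) * imY g (designPoint 3 g i) := by
      have : (A - B * tanPoint i) * imY g (designPoint 3 g i)
          = A * imY g (designPoint 3 g i) - B * imX g (designPoint 3 g i) := by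
        rw [hx]
        ring
      rw [this, hA, hB, imX, imY]
      ring
    have ht : 0 < tanPoint i ^ 2 + 1 := by positivity
    have hw4 := congrArg (fun z => z ^ 4) hw
    simp only [mul_pow] at hw4
    rw [div_div, designRatio, hg]
    generalize X * coordY (designPoint 3 g i) - Y * coordX (designPoint 3 g i) = z at hw4 ⊢
    generalize ∑ j, designRatio 3 g₀ g j = R at hR ⊢
    generalize polyVarExt 3 g₀ (designPoint 3 g i) = v at h0 ⊢
    generalize imY g (designPoint 3 g i) = y at hy hw4 ⊢
    field_simp
    linear_combination hw4
  simp only [hterm]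
  rw [← Finset.sum_div, Fin.sum_univ_three, gNormSq, ← hA, ← hB]
  have h3 : √(3 : ℝ) ^ 2 = 3 := Real.sq_sqrt (by norm_num)
  have h34 : √(3 : ℝ) ^ 4 = 9 := by
    rw [show √(3 : ℝ) ^ 4 = (√(3 : ℝ) ^ 2) ^ 2 by ring, h3]
    norm_num
  rw [div_mul_eq_mul_div]
  congr 1
  simp only [tanPoint, Matrix.cons_val_zero, Matrix.cons_val_one, Matrix.cons_val, neg_sq, h3]
  ring_nf
  rw [h3, h34]
  ring

lemma mobiusDesign_eq {g₀ g : GL (Fin 2) ℝ} {x : Fin 3 → OnePoint ℝ} {p : Fin 3 → ℝ} {k : ℝ}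
    (hx : ∀ i, imX g (x i) = tanPoint i * imY g (x i))
    (hp : ∀ i, p i / polyVarExt 3 g₀ (x i) * polyVarExt 3 g (x i) = k) (hsum : ∑ i, p i = 1) :
    ∑ i, Finsupp.single (x i) (p i) = mobiusDesign 3 g₀ g := by
  have hpt : ∀ i, designPoint 3 g i = x i := fun i => (designPoint_eq_iff g i _).mpr (hx i)
  have hpk : ∀ i, p i = k * designRatio 3 g₀ g i := by
    intro i
    have h1 := polyVarExt_pos g₀ (x i)
    have h2 := polyVarExt_pos g (x i)
    rw [designRatio, hpt, ← hp i]
    field_simp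
  have hk : k * ∑ j, designRatio 3 g₀ g j = 1 := by
    rw [Finset.mul_sum, ← hsum]
    exact Finset.sum_congr rfl fun i _ => (hpk i).symm
  rw [mobiusDesign]
  refine Finset.sum_congr rfl fun i _ => ?_
  rw [hpt, hpk, eq_one_div_of_mul_eq_one_left hk]
  congr 1
  ring

/-! ### Rigidity of three-point representations -/

/-- If one node of a three-point representation of a multiple of `(a² + b²)²` is the origin of the
projective line, then the other two are `±√3` and all weights agree. -/
lemma three_point_solution {w₁ w₂ w₃ B₁ A₂ B₂ A₃ B₃ K : ℝ} (hK : 0 < K)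
    (hA₂ : A₂ ≠ 0) (hA₃ : A₃ ≠ 0)
    (h : ∀ a b : ℝ, w₁ * (a * B₁) ^ 4 + w₂ * (a * B₂ - b * A₂) ^ 4 + w₃ * (a * B₃ - b * A₃) ^ 4
      = K * (a ^ 2 + b ^ 2) ^ 2) :
    (A₂ = √3 * B₂ ∧ A₃ = -√3 * B₃ ∨ A₂ = -√3 * B₂ ∧ A₃ = √3 * B₃) ∧
      w₁ * (B₁ ^ 2) ^ 2 = 8 / 9 * K ∧ w₂ * (A₂ ^ 2 + B₂ ^ 2) ^ 2 = 8 / 9 * K ∧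
      w₃ * (A₃ ^ 2 + B₃ ^ 2) ^ 2 = 8 / 9 * K := by
  obtain ⟨t₂, rfl⟩ : ∃ t, B₂ = A₂ * t := ⟨B₂ / A₂, by field_simp⟩
  obtain ⟨t₃, rfl⟩ : ∃ t, B₃ = A₃ * t := ⟨B₃ / A₃, by field_simp⟩
  -- the weights relative to `K` in the affine coordinate `B / A`
  obtain ⟨U₂, hU₂⟩ : ∃ U, w₂ * A₂ ^ 4 = U * K := ⟨w₂ * A₂ ^ 4 / K, by field_simp⟩
  obtain ⟨U₃, hU₃⟩ : ∃ U, w₃ * A₃ ^ 4 = U * K := ⟨w₃ * A₃ ^ 4 / K, by field_simp⟩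
  obtain ⟨U₁, hU₁⟩ : ∃ U, w₁ * B₁ ^ 4 = U * K := ⟨w₁ * B₁ ^ 4 / K, by field_simp⟩
  have h' : ∀ a b : ℝ, U₁ * a ^ 4 + U₂ * (a * t₂ - b) ^ 4 + U₃ * (a * t₃ - b) ^ 4
      = (a ^ 2 + b ^ 2) ^ 2 := by
    intro a b
    refine mul_right_cancel₀ hK.ne' ?_
    linear_combination h a b - a ^ 4 * hU₁ - (a * t₂ - b) ^ 4 * hU₂ - (a * t₃ - b) ^ 4 * hU₃
  have e0 := h' 0 1
  have e1 := h' 1 0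
  have e2 := h' 1 1
  have e3 := h' 1 (-1)
  have e4 := h' 1 2
  have m0 : U₂ + U₃ = 1 := by linarith
  have m1 : U₂ * t₂ + U₃ * t₃ = 0 := by linarith
  have m2 : U₂ * t₂ ^ 2 + U₃ * t₃ ^ 2 = 1 / 3 := by linarith
  have m3 : U₂ * t₂ ^ 3 + U₃ * t₃ ^ 3 = 0 := by linarith
  have m4 : U₁ + U₂ * t₂ ^ 4 + U₃ * t₃ ^ 4 = 1 := by linarith
  have hsum : t₃ = -t₂ := by linear_combination 3 * m3 - 3 * (t₂ + t₃) * m2 + 3 * t₂ * t₃ * m1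
  subst hsum
  have ht2 : t₂ ^ 2 = 1 / 3 := by linear_combination m2 - t₂ ^ 2 * m0
  have ht0 : t₂ ≠ 0 := by
    rintro rfl
    norm_num at ht2
  have hUU : U₂ = U₃ := by
    refine mul_right_cancel₀ ht0 ?_
    linear_combination m1
  subst hUU
  have hU : U₂ = 1 / 2 := by linarith
  subst hU
  have ht4 : t₂ ^ 4 = 1 / 9 := by
    rw [show t₂ ^ 4 = (t₂ ^ 2) ^ 2 by ring, ht2]
    norm_num
  have hU1 : U₁ = 8 / 9 := by linear_combination m4 - ht4
  subst hU1
  have h3 : √(3 : ℝ) ^ 2 = 3 := Real.sq_sqrt (by norm_num)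
  refine ⟨?_, ?_, ?_, ?_⟩
  · have : (√3 * t₂ - 1) * (√3 * t₂ + 1) = 0 := by
      linear_combination t₂ ^ 2 * h3 + 3 * ht2
    rcases mul_eq_zero.mp this with h | h
    · left
      constructor
      · linear_combination -A₂ * h
      · linear_combination -A₃ * h
    · right
      constructor
      · linear_combination A₂ * h
      · linear_combination A₃ * h
  · linear_combination hU₁
  · linear_combination 16 / 9 * hU₂ + w₂ * A₂ ^ 4 * (2 * ht2 + ht4)
  · linear_combination 16 / 9 * hU₃ + w₃ * A₃ ^ 4 * (2 * ht2 + ht4)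

/-- A rotation, as an element of `GL₂(ℝ)`. -/
noncomputable def rotGL (s t : ℝ) (h : s ^ 2 + t ^ 2 = 1) : GL (Fin 2) ℝ :=
  mkGL s (-t) t s (by rw [show s * s - -t * t = 1 by linear_combination h]; exact one_ne_zero)

lemma isRotation_rotGL {s t : ℝ} (h : s ^ 2 + t ^ 2 = 1) : IsRotation (rotGL s t h) :=
  ⟨s, t, h, rfl⟩

lemma IsRotation.gNormSq_mul {r : GL (Fin 2) ℝ} (hr : IsRotation r) (g : GL (Fin 2) ℝ) (X Y : ℝ) :
    gNormSq (r * g) X Y = gNormSq g X Y := by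
  obtain ⟨s, t, hst, hr⟩ := hr
  simp only [gNormSq, Units.val_mul, hr, Matrix.mul_apply, Fin.sum_univ_two]
  simp
  linear_combination ((g 0 0 * X + g 0 1 * Y) ^ 2 + (g 1 0 * X + g 1 1 * Y) ^ 2) * hst

lemma IsNormSquare.rotate {r g : GL (Fin 2) ℝ} (hr : IsRotation r) {m : Fin 5 → ℝ} :
    IsNormSquare (r * g) m ↔ IsNormSquare g m := by
  simp only [IsNormSquare, hr.gNormSq_mul]

lemma imX_rotGL_mul {s t : ℝ} (h : s ^ 2 + t ^ 2 = 1) (g : GL (Fin 2) ℝ) (x : OnePoint ℝ) :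
    imX (rotGL s t h * g) x = s * imX g x - t * imY g x := by
  simp only [imX, imY, rotGL, Units.val_mul, Matrix.mul_apply, Fin.sum_univ_two, mkGL_00, mkGL_01]
  ring

lemma exists_eq_sum_single {ξ : OnePoint ℝ →₀ ℝ} (hξ : IsPointDesign 3 ξ) :
    ∃ (x : Fin 3 → OnePoint ℝ) (p : Fin 3 → ℝ), Function.Injective x ∧ (∀ i, 0 < p i) ∧
      ∑ i, p i = 1 ∧ ξ = ∑ i, Finsupp.single (x i) (p i) := by
  classical
  obtain ⟨hnn, hsum, hcard⟩ := hξ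
  let e := ξ.support.equivFinOfCardEq hcard
  have hs : ∀ {M : Type} [AddCommMonoid M] (f : OnePoint ℝ → M),
      ∑ i, f (e.symm i : OnePoint ℝ) = ∑ x ∈ ξ.support, f x := by
    intro M _ f
    rw [← Finset.sum_coe_sort ξ.support f]
    exact Equiv.sum_comp e.symm (fun y : ξ.support => f y)
  refine ⟨fun i => e.symm i, fun i => ξ (e.symm i), ?_, fun i => ?_, ?_, ?_⟩
  · exact Subtype.val_injective.comp e.symm.injective
  · exact lt_of_le_of_ne (hnn _) (Ne.symm (Finsupp.mem_support_iff.mp (e.symm i).2))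
  · rw [hs fun x => ξ x]
    exact hsum
  · rw [hs fun x => Finsupp.single x (ξ x)]
    exact (Finsupp.sum_single ξ).symm

lemma eq_mobiusDesign_of_imX_eq_zero {g₀ g : GL (Fin 2) ℝ} {x : Fin 3 → OnePoint ℝ}
    (hx : Function.Injective x) {p : Fin 3 → ℝ} (hsum : ∑ i, p i = 1)
    (h : IsNormSquare g (designMoments g₀ (∑ i, Finsupp.single (x i) (p i))))
    (h0 : imX g (x 0) = 0) :
    ∑ i, Finsupp.single (x i) (p i) = mobiusDesign 3 g₀ g := by
  obtain ⟨κ, hκ, hm⟩ := h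
  have hD := det_entries_ne_zero g
  have hne : ∀ i, i ≠ 0 → imX g (x i) ≠ 0 := by
    intro i hi hi0
    apply hi
    apply hx
    have h1 := (designPoint_eq_iff g 1 (x i)).mpr (by simpa [tanPoint] using hi0)
    have h2 := (designPoint_eq_iff g 1 (x 0)).mpr (by simpa [tanPoint] using h0)
    rw [← h1, ← h2]
  have hK : 0 < κ * (g 0 0 * g 1 1 - g 0 1 * g 1 0) ^ 4 := by positivity
  obtain ⟨hcase, hw₁, hw₂, hw₃⟩ := three_point_solution (w₁ := p 0 / polyVarExt 3 g₀ (x 0))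
    (w₂ := p 1 / polyVarExt 3 g₀ (x 1)) (w₃ := p 2 / polyVarExt 3 g₀ (x 2)) (B₁ := imY g (x 0))
    (B₂ := imY g (x 1)) (B₃ := imY g (x 2)) hK
    (hne 1 (by decide)) (hne 2 (by decide)) (by
      intro a b
      -- evaluate the quartic form at the image of `(a, b)` under the adjugate of `g`
      have e := hm (g 1 1 * a - g 0 1 * b) (-g 1 0 * a + g 0 0 * b)
      rw [quartic_designMoments_sum_single, Fin.sum_univ_three] at e
      have hw : ∀ y, (g 1 1 * a - g 0 1 * b) * coordY y - (-g 1 0 * a + g 0 0 * b) * coordX y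
          = a * imY g y - b * imX g y := by
        intro y
        simp only [imX, imY]
        ring
      have hn : gNormSq g (g 1 1 * a - g 0 1 * b) (-g 1 0 * a + g 0 0 * b)
          = (g 0 0 * g 1 1 - g 0 1 * g 1 0) ^ 2 * (a ^ 2 + b ^ 2) := by
        simp only [gNormSq]
        ring
      rw [hw, hw, hw, hn, h0] at e
      linear_combination e)
  have hv0 : p 0 / polyVarExt 3 g₀ (x 0) * polyVarExt 3 g (x 0)
      = 8 / 9 * (κ * (g 0 0 * g 1 1 - g 0 1 * g 1 0) ^ 4) := by
    rw [polyVarExt_eq g, h0, ← hw₁]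
    ring
  rw [← polyVarExt_eq g] at hw₂ hw₃
  rw [Fin.sum_univ_three] at hsum
  rcases hcase with ⟨h2, h3⟩ | ⟨h2, h3⟩
  · rw [← mobiusDesign_eq (x := ![x 2, x 0, x 1]) (p := ![p 2, p 0, p 1])
      (k := 8 / 9 * (κ * (g 0 0 * g 1 1 - g 0 1 * g 1 0) ^ 4))]
    · simp only [Fin.sum_univ_three, Matrix.cons_val_zero, Matrix.cons_val_one, Matrix.cons_val]
      abel
    · intro i
      fin_cases i <;> simp [tanPoint, h0, h2, h3]
    · intro i
      fin_cases i <;> simp [hv0, hw₂, hw₃]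
    · simp [Fin.sum_univ_three]
      linarith
  · rw [← mobiusDesign_eq (x := ![x 1, x 0, x 2]) (p := ![p 1, p 0, p 2])
      (k := 8 / 9 * (κ * (g 0 0 * g 1 1 - g 0 1 * g 1 0) ^ 4))]
    · simp only [Fin.sum_univ_three, Matrix.cons_val_zero, Matrix.cons_val_one, Matrix.cons_val]
      abel
    · intro i
      fin_cases i <;> simp [tanPoint, h0, h2, h3]
    · intro i
      fin_cases i <;> simp [hv0, hw₂, hw₃]
    · simp [Fin.sum_univ_three]
      linarith

/-- A three-point design whose quartic form is a multiple of `|g ·|⁴` belongs to the Möbius family: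
after a rotation one of its points is sent to `0`, which determines the others. -/
lemma exists_eq_mobiusDesign {g₀ g : GL (Fin 2) ℝ} {ξ : OnePoint ℝ →₀ ℝ}
    (hξ : IsPointDesign 3 ξ) (h : IsNormSquare g (designMoments g₀ ξ)) :
    ∃ r, IsRotation r ∧ ξ = mobiusDesign 3 g₀ (r * g) := by
  obtain ⟨x, p, hx, -, hsum, rfl⟩ := exists_eq_sum_single hξ
  have hn : 0 < imX g (x 0) ^ 2 + imY g (x 0) ^ 2 := by
    rcases not_and_or.mp (im_ne_zero g (x 0)) with h | h <;> positivity
  have hs := Real.sq_sqrt hn.le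
  have hs0 := Real.sqrt_pos.mpr hn
  set n := √(imX g (x 0) ^ 2 + imY g (x 0) ^ 2) with hn_def
  have hst : (imY g (x 0) / n) ^ 2 + (imX g (x 0) / n) ^ 2 = 1 := by
    field_simp
    linarith
  refine ⟨rotGL _ _ hst, isRotation_rotGL hst, ?_⟩
  refine eq_mobiusDesign_of_imX_eq_zero hx hsum
    ((IsNormSquare.rotate (isRotation_rotGL hst)).mpr h) ?_
  rw [imX_rotGL_mul]
  ring

/-! ### Realization by measures on the real line -/

lemma designPoint_eq_infty_iff (g : GL (Fin 2) ℝ) (i : Fin 3) :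
    designPoint 3 g i = ∞ ↔ g 0 0 = tanPoint i * g 1 0 := by
  rw [designPoint_eq_iff]
  simp [imX, imY]

lemma eq_zero_or_sq_of_eq_tanPoint_mul {i : Fin 3} {x y : ℝ} (h : x = tanPoint i * y) :
    x = 0 ∨ x ^ 2 = 3 * y ^ 2 := by
  have h3 : √(3 : ℝ) ^ 2 = 3 := Real.sq_sqrt (by norm_num)
  fin_cases i
  · right
    simp only [h, tanPoint]
    simp [mul_pow]
  · left
    simpa [tanPoint] using h
  · right
    simp only [h, tanPoint]
    simp [mul_pow]

/-- The triple of design points and its image under a quarter turn cannot both contain `∞`. -/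
lemma exists_rotation_designPoint_ne_infty (g : GL (Fin 2) ℝ) :
    ∃ r, IsRotation r ∧ ∀ i, designPoint 3 (r * g) i ≠ ∞ := by
  by_contra! hcon
  have h10 : (1 : ℝ) ^ 2 + 0 ^ 2 = 1 := by norm_num
  have h01 : (0 : ℝ) ^ 2 + 1 ^ 2 = 1 := by norm_num
  obtain ⟨i, hi⟩ := hcon _ (isRotation_rotGL h10)
  obtain ⟨j, hj⟩ := hcon _ (isRotation_rotGL h01)
  rw [designPoint_eq_infty_iff] at hi hj
  simp only [rotGL, Units.val_mul, Matrix.mul_apply, Fin.sum_univ_two, mkGL_00, mkGL_01, mkGL_10,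
    mkGL_11, zero_mul, one_mul, neg_zero, add_zero, zero_add] at hi hj
  have hD := det_entries_ne_zero g
  have hzero : g 0 0 = 0 ∧ g 1 0 = 0 := by
    rcases eq_zero_or_sq_of_eq_tanPoint_mul hi with h1 | h1 <;>
    rcases eq_zero_or_sq_of_eq_tanPoint_mul hj with h2 | h2 <;>
    constructor <;> nlinarith
  exact hD (by rw [hzero.1, hzero.2]; ring)

lemma infoMoments_sum_dirac (g₀ : GL (Fin 2) ℝ) (x p : Fin 3 → ℝ) (hp : ∀ i, 0 ≤ p i) :
    infoMoments g₀ (∑ i, ENNReal.ofReal (p i) • Measure.dirac (x i))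
      = designMoments g₀ (∑ i, Finsupp.single (x i : OnePoint ℝ) (p i)) := by
  ext k
  rw [infoMoments, designMoments_sum_single, integral_finsetSum_measure]
  · refine Finset.sum_congr rfl fun i _ => ?_
    rw [integral_smul_measure, integral_dirac, ENNReal.toReal_ofReal (hp i)]
    simp [polyVarExt]
    ring
  · intro i _
    exact (integrable_dirac (by simp [enorm_lt_top])).smul_measure ENNReal.ofReal_ne_top

/-- A matrix whose quartic form is a multiple of `|g ·|⁴` is the information matrix of a measure on
three real points. -/
lemma IsNormSquare.exists_infoMoments_eq (g₀ : GL (Fin 2) ℝ) {g : GL (Fin 2) ℝ} {m : Fin 5 → ℝ}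
    (h : IsNormSquare g m) : ∃ ρ : Measure ℝ, IsFiniteMeasure ρ ∧ infoMoments g₀ ρ = m := by
  obtain ⟨r, hr, hfin⟩ := exists_rotation_designPoint_ne_infty g
  have hx : ∀ i, ∃ x : ℝ, (x : OnePoint ℝ) = designPoint 3 (r * g) i := fun i =>
    OnePoint.ne_infty_iff_exists.mp (hfin i)
  choose x hx using hx
  obtain ⟨κ, hκ, hm⟩ := h
  obtain ⟨κ', hκ', hm'⟩ :=
    (IsNormSquare.rotate hr).mp (mobiusDesign_isNormSquare g₀ (r * g))
  have hR := sum_designRatio_pos g₀ (r * g)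
  refine ⟨∑ i, ENNReal.ofReal (κ / κ' * (designRatio 3 g₀ (r * g) i /
    ∑ j, designRatio 3 g₀ (r * g) j)) • Measure.dirac (x i), ?_, ?_⟩
  · refine ⟨?_⟩
    simp [ENNReal.sum_lt_top, ENNReal.ofReal_lt_top]
  · rw [infoMoments_sum_dirac g₀ x _ fun i =>
      mul_nonneg (by positivity) (div_nonneg (designRatio_pos g₀ _ i).le hR.le)]
    apply quartic_injective
    intro X Y
    rw [hm, quartic_designMoments_sum_single]
    have e := hm' X Y
    rw [mobiusDesign, quartic_designMoments_sum_single] at e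
    have e' : κ * gNormSq g X Y ^ 2 = κ / κ' * (κ' * gNormSq g X Y ^ 2) := by
      field_simp
    rw [e', ← e, Finset.mul_sum]
    refine Finset.sum_congr rfl fun i _ => ?_
    rw [hx]
    ring

lemma IsNormSquare.hankel_mem_infoCone (g₀ : GL (Fin 2) ℝ) {g : GL (Fin 2) ℝ} {m : Fin 5 → ℝ}
    (h : IsNormSquare g m) : hankel m ∈ infoCone 3 g₀ := by
  obtain ⟨ρ, hρ, hm⟩ := h.exists_infoMoments_eq g₀
  exact ⟨h.posDef, ρ, hρ, by rw [infoMatrix_eq, hm]⟩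

/-! ### The determinant of an information matrix -/

/-- The pairing of a moment sequence with the quartic polynomial `|g (x, 1)|⁴`. -/
def normPairing (g : GL (Fin 2) ℝ) (m : Fin 5 → ℝ) : ℝ :=
  (g 0 1 ^ 2 + g 1 1 ^ 2) ^ 2 * m 0
    + 4 * (g 0 0 * g 0 1 + g 1 0 * g 1 1) * (g 0 1 ^ 2 + g 1 1 ^ 2) * m 1
    + (2 * (g 0 0 ^ 2 + g 1 0 ^ 2) * (g 0 1 ^ 2 + g 1 1 ^ 2)
      + 4 * (g 0 0 * g 0 1 + g 1 0 * g 1 1) ^ 2) * m 2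
    + 4 * (g 0 0 ^ 2 + g 1 0 ^ 2) * (g 0 0 * g 0 1 + g 1 0 * g 1 1) * m 3
    + (g 0 0 ^ 2 + g 1 0 ^ 2) ^ 2 * m 4

/-- The moments of the image of the representing measure under the linear map `g`, in homogeneous
coordinates: its quartic form is that of `m` composed with the adjugate of `g`. -/
def pushMoments (g : GL (Fin 2) ℝ) (m : Fin 5 → ℝ) : Fin 5 → ℝ :=
  changeVar (g 1 1) (-g 0 1) (-g 1 0) (g 0 0) m

lemma normPairing_eq (g : GL (Fin 2) ℝ) (m : Fin 5 → ℝ) :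
    normPairing g m = pushMoments g m 0 + 2 * pushMoments g m 2 + pushMoments g m 4 := by
  simp [normPairing, pushMoments, changeVar]
  ring

lemma catalecticant_pushMoments (g : GL (Fin 2) ℝ) (m : Fin 5 → ℝ) :
    catalecticant (pushMoments g m)
      = (g 0 0 * g 1 1 - g 0 1 * g 1 0) ^ 6 * catalecticant m := by
  rw [pushMoments, catalecticant_changeVar]
  congr 2
  ring

lemma isNormSquare_of_pushMoments {g : GL (Fin 2) ℝ} {m : Fin 5 → ℝ} {k : ℝ} (hk : 0 < k)
    (h : pushMoments g m = ![k, 0, k / 3, 0, k]) : IsNormSquare g m := by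
  have hD := det_entries_ne_zero g
  refine ⟨k / (g 0 0 * g 1 1 - g 0 1 * g 1 0) ^ 4, by positivity, fun X Y => ?_⟩
  have h1 := quartic_changeVar (g 1 1) (-g 0 1) (-g 1 0) (g 0 0) m
    (g 0 0 * X + g 0 1 * Y) (g 1 0 * X + g 1 1 * Y)
  rw [← pushMoments, h] at h1
  have h2 : quartic m
      (g 1 1 * (g 0 0 * X + g 0 1 * Y) + -g 0 1 * (g 1 0 * X + g 1 1 * Y))
      (-g 1 0 * (g 0 0 * X + g 0 1 * Y) + g 0 0 * (g 1 0 * X + g 1 1 * Y))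
      = (g 0 0 * g 1 1 - g 0 1 * g 1 0) ^ 4 * quartic m X Y := by
    simp only [quartic]
    ring
  rw [h2] at h1
  rw [div_mul_eq_mul_div, eq_div_iff (pow_ne_zero 4 hD), mul_comm, ← h1]
  simp [quartic, gNormSq]
  ring

lemma IsNormSquare.pushMoments_eq {g : GL (Fin 2) ℝ} {m : Fin 5 → ℝ} (h : IsNormSquare g m)
    (hp : normPairing g m = 1) : pushMoments g m = ![3 / 8, 0, 1 / 8, 0, 3 / 8] := by
  obtain ⟨κ, hκ, hm⟩ := h
  have h1 : pushMoments g m = (fun i => κ * (g 0 0 * g 1 1 - g 0 1 * g 1 0) ^ 4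
      * (![1, 0, 1 / 3, 0, 1] : Fin 5 → ℝ) i) := by
    apply quartic_injective
    intro X Y
    rw [pushMoments, quartic_changeVar, hm]
    simp [quartic, gNormSq]
    ring
  rw [normPairing_eq, h1] at hp
  rw [h1]
  simp at hp
  ext i
  fin_cases i <;> simp <;> linarith

lemma hankel_posSemidef_iff (m : Fin 5 → ℝ) : (hankel m).PosSemidef ↔ ∀ x y z : ℝ,
    0 ≤ m 0 * x ^ 2 + 2 * m 1 * x * y + m 2 * (y ^ 2 + 2 * x * z) + 2 * m 3 * y * z
      + m 4 * z ^ 2 := by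
  have hH : (hankel m).IsHermitian := by
    ext i j
    fin_cases i <;> fin_cases j <;> simp [hankel]
  rw [Matrix.posSemidef_iff_dotProduct_mulVec]
  constructor
  · intro h x y z
    have := h.2 ![x, y, z]
    simp [hankel, Matrix.mulVec, dotProduct, Fin.sum_univ_three] at this
    linarith
  · intro h
    refine ⟨hH, fun v => ?_⟩
    have := h (v 0) (v 1) (v 2)
    simp [hankel, Matrix.mulVec, dotProduct, Fin.sum_univ_three]
    linarith

/-- Hadamard's inequality in the basis `1, cos 2θ, sin 2θ`, followed by the inequality between the
arithmetic and the geometric mean. -/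
lemma catalecticant_le {m : Fin 5 → ℝ} (hm : (hankel m).PosSemidef)
    (h1 : m 0 + 2 * m 2 + m 4 = 1) :
    catalecticant m ≤ 1 / 64 ∧
      (1 / 64 ≤ catalecticant m → m = ![3 / 8, 0, 1 / 8, 0, 3 / 8]) := by
  rw [hankel_posSemidef_iff] at hm
  -- means of `cos 2θ` and `sin 2θ`, their variances and their covariance
  obtain ⟨p, hp⟩ : ∃ p, p = m 4 - m 0 := ⟨_, rfl⟩
  obtain ⟨q, hq⟩ : ∃ q, q = 2 * (m 1 + m 3) := ⟨_, rfl⟩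
  obtain ⟨α, hα⟩ : ∃ α, α = m 4 - 2 * m 2 + m 0 - p ^ 2 := ⟨_, rfl⟩
  obtain ⟨β, hβ⟩ : ∃ β, β = 4 * m 2 - q ^ 2 := ⟨_, rfl⟩
  obtain ⟨r, hr⟩ : ∃ r, r = 2 * (m 3 - m 1) - p * q := ⟨_, rfl⟩
  have hα0 : 0 ≤ α := by
    have := hm (-1 - p) 0 (1 - p)
    have e : α = m 0 * (-1 - p) ^ 2 + 2 * m 1 * (-1 - p) * 0
        + m 2 * (0 ^ 2 + 2 * (-1 - p) * (1 - p)) + 2 * m 3 * 0 * (1 - p) + m 4 * (1 - p) ^ 2 := by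
      linear_combination hα - p ^ 2 * h1 - 2 * p * hp
    rw [e]
    exact this
  have hβ0 : 0 ≤ β := by
    have := hm (-q) 2 (-q)
    have e : β = m 0 * (-q) ^ 2 + 2 * m 1 * (-q) * 2
        + m 2 * (2 ^ 2 + 2 * (-q) * (-q)) + 2 * m 3 * 2 * (-q) + m 4 * (-q) ^ 2 := by
      linear_combination hβ - q ^ 2 * h1 - 2 * q * hq
    rw [e]
    exact this
  have hdet : 16 * catalecticant m = α * β - r ^ 2 := by
    have h4 : m 4 = 1 - m 0 - 2 * m 2 := by linarith
    rw [hα, hβ, hr, hp, hq, catalecticant, h4]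
    ring
  have hsum : α + β = 1 - p ^ 2 - q ^ 2 := by
    rw [hα, hβ]
    linear_combination h1
  have hle : α + β ≤ 1 := by nlinarith [sq_nonneg p, sq_nonneg q]
  have hmul : 4 * (α * β) ≤ (α + β) ^ 2 := by nlinarith [sq_nonneg (α - β)]
  have hsq : (α + β) ^ 2 ≤ 1 := by nlinarith
  refine ⟨by nlinarith [sq_nonneg r], fun hge => ?_⟩
  have hr0 : r = 0 := by
    have : r ^ 2 ≤ 0 := by nlinarith
    exact pow_eq_zero_iff two_ne_zero |>.mp (le_antisymm this (sq_nonneg r))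
  have hone : 1 ≤ α + β := by nlinarith [sq_nonneg r]
  have hp0 : p = 0 := by
    have : p ^ 2 ≤ 0 := by nlinarith [sq_nonneg q]
    exact pow_eq_zero_iff two_ne_zero |>.mp (le_antisymm this (sq_nonneg p))
  have hq0 : q = 0 := by
    have : q ^ 2 ≤ 0 := by nlinarith [sq_nonneg p]
    exact pow_eq_zero_iff two_ne_zero |>.mp (le_antisymm this (sq_nonneg q))
  have hαβ : α - β = 0 := by
    have : (α - β) ^ 2 ≤ 0 := by nlinarith [sq_nonneg r]
    exact pow_eq_zero_iff two_ne_zero |>.mp (le_antisymm this (sq_nonneg _))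
  subst hp0 hq0 hr0
  ext i
  fin_cases i <;> simp <;> linarith

lemma posSemidef_pushMoments (g : GL (Fin 2) ℝ) {m : Fin 5 → ℝ} (hm : (hankel m).PosSemidef) :
    (hankel (pushMoments g m)).PosSemidef := by
  rw [pushMoments, hankel_changeVar]
  exact hm.mul_mul_conjTranspose_same _

/-- The largest determinant of an information matrix of total mass one. -/
noncomputable def maxDet (g : GL (Fin 2) ℝ) : ℝ := 1 / 64 / (g 0 0 * g 1 1 - g 0 1 * g 1 0) ^ 6

lemma det_hankel_le_maxDet {g : GL (Fin 2) ℝ} {m : Fin 5 → ℝ} (hm : (hankel m).PosSemidef)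
    (hp : normPairing g m = 1) : (hankel m).det ≤ maxDet g := by
  have hD := det_entries_ne_zero g
  have h := (catalecticant_le (posSemidef_pushMoments g hm) (by rw [← normPairing_eq, hp])).1
  rw [catalecticant_pushMoments] at h
  rw [hankel_det, maxDet, le_div_iff₀ (by positivity), mul_comm]
  exact h

lemma isNormSquare_of_maxDet_le {g : GL (Fin 2) ℝ} {m : Fin 5 → ℝ} (hm : (hankel m).PosSemidef)
    (hp : normPairing g m = 1) (hle : maxDet g ≤ (hankel m).det) : IsNormSquare g m := by
  have hD := det_entries_ne_zero g
  have h := (catalecticant_le (posSemidef_pushMoments g hm) (by rw [← normPairing_eq, hp])).2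
  rw [catalecticant_pushMoments] at h
  rw [hankel_det, maxDet, div_le_iff₀ (by positivity), mul_comm] at hle
  refine isNormSquare_of_pushMoments (k := 3 / 8) (by norm_num) ?_
  rw [h hle]
  norm_num

lemma IsNormSquare.det_eq_maxDet {g : GL (Fin 2) ℝ} {m : Fin 5 → ℝ} (h : IsNormSquare g m)
    (hp : normPairing g m = 1) : (hankel m).det = maxDet g := by
  have hD := det_entries_ne_zero g
  have h1 := catalecticant_pushMoments g m
  rw [h.pushMoments_eq hp] at h1
  rw [hankel_det, maxDet, eq_div_iff (by positivity), mul_comm, ← h1]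
  simp [catalecticant]
  norm_num

section Designs

variable {g₀ : GL (Fin 2) ℝ}

lemma normPairing_designMoments (ξ : OnePoint ℝ →₀ ℝ) :
    normPairing g₀ (designMoments g₀ ξ) = ξ.sum fun _ p => p := by
  simp only [normPairing, designMoments, Finsupp.sum, Finset.mul_sum, ← Finset.sum_add_distrib]
  refine Finset.sum_congr rfl fun x _ => ?_
  have h := polyVarExt_pos g₀ x
  have e := polyVarExt_eq g₀ x
  rw [imX, imY] at e
  generalize polyVarExt 3 g₀ x = v at h e
  norm_num
  field_simp
  rw [e]
  ring

lemma hankel_designMoments_posSemidef {ξ : OnePoint ℝ →₀ ℝ} (hξ : ∀ x, 0 ≤ ξ x) :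
    (hankel (designMoments g₀ ξ)).PosSemidef := by
  rw [hankel_posSemidef_iff]
  intro x y z
  have e : designMoments g₀ ξ 0 * x ^ 2 + 2 * designMoments g₀ ξ 1 * x * y
        + designMoments g₀ ξ 2 * (y ^ 2 + 2 * x * z) + 2 * designMoments g₀ ξ 3 * y * z
        + designMoments g₀ ξ 4 * z ^ 2
      = ξ.sum fun u p => p / polyVarExt 3 g₀ u
        * (x * coordY u ^ 2 + y * (coordX u * coordY u) + z * coordX u ^ 2) ^ 2 := by
    simp only [designMoments, Finsupp.sum, Finset.mul_sum, Finset.sum_mul,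
      ← Finset.sum_add_distrib]
    refine Finset.sum_congr rfl fun u _ => ?_
    norm_num
    ring
  rw [e]
  exact Finset.sum_nonneg fun u _ =>
    mul_nonneg (div_nonneg (hξ u) (polyVarExt_pos g₀ u).le) (sq_nonneg _)

lemma polyVar_pos (x : ℝ) : 0 < polyVar 3 g₀ x := polyVarExt_pos g₀ (x : OnePoint ℝ)

lemma continuous_polyVar : Continuous (polyVar 3 g₀) := by
  unfold polyVar
  fun_prop

lemma one_add_sq_sq_le_polyVar (x : ℝ) :
    (g₀ 0 0 * g₀ 1 1 - g₀ 0 1 * g₀ 1 0) ^ 4 * (1 + x ^ 2) ^ 2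
      ≤ (g₀ 0 0 ^ 2 + g₀ 0 1 ^ 2 + g₀ 1 0 ^ 2 + g₀ 1 1 ^ 2) ^ 2 * polyVar 3 g₀ x := by
  have h1 : (g₀ 0 0 * g₀ 1 1 - g₀ 0 1 * g₀ 1 0) ^ 2 * (1 + x ^ 2)
      ≤ (g₀ 0 0 ^ 2 + g₀ 0 1 ^ 2 + g₀ 1 0 ^ 2 + g₀ 1 1 ^ 2)
        * ((g₀ 0 0 * x + g₀ 0 1) ^ 2 + (g₀ 1 0 * x + g₀ 1 1) ^ 2) := by
    -- the difference of the two sides is a sum of two squares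
    nlinarith [sq_nonneg (g₀ 1 1 * (g₀ 1 0 * x + g₀ 1 1) + g₀ 0 1 * (g₀ 0 0 * x + g₀ 0 1)),
      sq_nonneg (g₀ 1 0 * (g₀ 1 0 * x + g₀ 1 1) + g₀ 0 0 * (g₀ 0 0 * x + g₀ 0 1))]
  have h2 := pow_le_pow_left₀ (by positivity) h1 2
  refine (le_of_eq ?_).trans (h2.trans (le_of_eq ?_))
  · ring
  · simp only [polyVar]
    ring

lemma integrable_pow_div_polyVar (ρ : Measure ℝ) [IsFiniteMeasure ρ] {k : ℕ} (hk : k ≤ 4) :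
    Integrable (fun x => x ^ k / polyVar 3 g₀ x) ρ := by
  have hD := det_entries_ne_zero g₀
  refine Integrable.of_bound (C := (g₀ 0 0 ^ 2 + g₀ 0 1 ^ 2 + g₀ 1 0 ^ 2 + g₀ 1 1 ^ 2) ^ 2
    / (g₀ 0 0 * g₀ 1 1 - g₀ 0 1 * g₀ 1 0) ^ 4) ?_ (Filter.Eventually.of_forall fun x => ?_)
  · exact ((continuous_pow k).div continuous_polyVar
      fun x => (polyVar_pos x).ne').aestronglyMeasurable
  · have hv := polyVar_pos (g₀ := g₀) x
    have hpow : |x| ^ k ≤ (1 + x ^ 2) ^ 2 := by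
      have hx := abs_nonneg x
      rw [← sq_abs x]
      interval_cases k <;> nlinarith [sq_nonneg (|x| - 1), sq_nonneg (|x| ^ 2)]
    rw [norm_div, norm_pow, Real.norm_eq_abs, Real.norm_of_nonneg hv.le, div_le_iff₀ hv,
      div_mul_eq_mul_div, le_div_iff₀ (by positivity)]
    refine le_trans ?_ (one_add_sq_sq_le_polyVar x)
    rw [mul_comm]
    exact mul_le_mul_of_nonneg_left hpow (by positivity)

lemma sum_mul_infoMoments (ρ : Measure ℝ) [IsFiniteMeasure ρ] (a : Fin 5 → ℝ) :
    ∑ k, a k * infoMoments g₀ ρ k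
      = ∫ x, (∑ k, a k * x ^ (k : ℕ)) / polyVar 3 g₀ x ∂ρ := by
  simp only [infoMoments, ← integral_const_mul]
  rw [← integral_finsetSum _ fun k _ =>
    (integrable_pow_div_polyVar ρ (Nat.lt_succ_iff.mp k.2)).const_mul _]
  refine integral_congr_ae (Filter.Eventually.of_forall fun x => ?_)
  simp only [Finset.sum_div, mul_div_assoc]

lemma normPairing_infoMoments (ρ : Measure ℝ) [IsFiniteMeasure ρ] :
    normPairing g₀ (infoMoments g₀ ρ) = ρ.real Set.univ := by
  have h := sum_mul_infoMoments (g₀ := g₀) ρ ![(g₀ 0 1 ^ 2 + g₀ 1 1 ^ 2) ^ 2,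
    4 * (g₀ 0 0 * g₀ 0 1 + g₀ 1 0 * g₀ 1 1) * (g₀ 0 1 ^ 2 + g₀ 1 1 ^ 2),
    2 * (g₀ 0 0 ^ 2 + g₀ 1 0 ^ 2) * (g₀ 0 1 ^ 2 + g₀ 1 1 ^ 2)
      + 4 * (g₀ 0 0 * g₀ 0 1 + g₀ 1 0 * g₀ 1 1) ^ 2,
    4 * (g₀ 0 0 ^ 2 + g₀ 1 0 ^ 2) * (g₀ 0 0 * g₀ 0 1 + g₀ 1 0 * g₀ 1 1),
    (g₀ 0 0 ^ 2 + g₀ 1 0 ^ 2) ^ 2]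
  have e : ∀ x : ℝ, (∑ k, ![(g₀ 0 1 ^ 2 + g₀ 1 1 ^ 2) ^ 2,
    4 * (g₀ 0 0 * g₀ 0 1 + g₀ 1 0 * g₀ 1 1) * (g₀ 0 1 ^ 2 + g₀ 1 1 ^ 2),
    2 * (g₀ 0 0 ^ 2 + g₀ 1 0 ^ 2) * (g₀ 0 1 ^ 2 + g₀ 1 1 ^ 2)
      + 4 * (g₀ 0 0 * g₀ 0 1 + g₀ 1 0 * g₀ 1 1) ^ 2,
    4 * (g₀ 0 0 ^ 2 + g₀ 1 0 ^ 2) * (g₀ 0 0 * g₀ 0 1 + g₀ 1 0 * g₀ 1 1),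
    (g₀ 0 0 ^ 2 + g₀ 1 0 ^ 2) ^ 2] k * x ^ ((k : Fin 5) : ℕ)) / polyVar 3 g₀ x = 1 := by
    intro x
    rw [div_eq_one_iff_eq (polyVar_pos x).ne', Fin.sum_univ_five]
    simp [polyVar]
    ring
  simp only [e] at h
  rw [integral_const, smul_eq_mul, mul_one] at h
  rw [← h, Fin.sum_univ_five]
  simp [normPairing]

lemma hankel_infoMoments_posSemidef (ρ : Measure ℝ) [IsFiniteMeasure ρ] :
    (hankel (infoMoments g₀ ρ)).PosSemidef := by
  rw [hankel_posSemidef_iff]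
  intro x y z
  have h := sum_mul_infoMoments (g₀ := g₀) ρ
    ![x ^ 2, 2 * x * y, y ^ 2 + 2 * x * z, 2 * y * z, z ^ 2]
  have hnn : 0 ≤ ∫ u, (∑ k, ![x ^ 2, 2 * x * y, y ^ 2 + 2 * x * z, 2 * y * z, z ^ 2] k
      * u ^ ((k : Fin 5) : ℕ)) / polyVar 3 g₀ u ∂ρ := by
    refine integral_nonneg fun u => div_nonneg ?_ (polyVar_pos u).le
    have e : ∑ k, ![x ^ 2, 2 * x * y, y ^ 2 + 2 * x * z, 2 * y * z, z ^ 2] k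
        * u ^ ((k : Fin 5) : ℕ) = (x + y * u + z * u ^ 2) ^ 2 := by
      rw [Fin.sum_univ_five]
      simp
      ring
    rw [e]
    positivity
  rw [← h, Fin.sum_univ_five] at hnn
  simp at hnn
  linarith

/-! ### Optimality -/

lemma tubeVolume_hankel_of_isNormSquare {g : GL (Fin 2) ℝ} {m : Fin 5 → ℝ}
    (h : IsNormSquare g m) : tubeVolume 3 (hankel m)⁻¹ = 2 * (2 * √(2 / 3) * Real.pi) := by
  rw [tubeVolume_hankel_inv h.posDef, h.curveLength_eq]

lemma isTubeVolumeOptimal_iff {ξ : OnePoint ℝ →₀ ℝ} :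
    IsTubeVolumeOptimal 3 g₀ ξ ↔ ∃ g, IsNormSquare g (designMoments g₀ ξ) := by
  rw [IsTubeVolumeOptimal, designMatrix_eq]
  constructor
  · rintro ⟨⟨hpd, -⟩, hmin⟩
    have h1 := mobiusDesign_isNormSquare g₀ g₀
    have h2 := hmin _ (h1.hankel_mem_infoCone g₀)
    rw [tubeVolume_hankel_of_isNormSquare h1, tubeVolume_hankel_inv hpd] at h2
    exact exists_isNormSquare_of_curveLength_le hpd (le_of_mul_le_mul_left h2 two_pos)
  · rintro ⟨g, hg⟩
    refine ⟨hg.hankel_mem_infoCone g₀, ?_⟩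
    rintro M ⟨hpd, ρ, -, rfl⟩
    rw [infoMatrix_eq] at hpd ⊢
    rw [tubeVolume_hankel_of_isNormSquare hg, tubeVolume_hankel_inv hpd]
    exact mul_le_mul_of_nonneg_left (curveLength_ge hpd) two_pos.le

lemma isDOptimal_iff {ξ : OnePoint ℝ →₀ ℝ} (hξ : IsPointDesign 3 ξ) :
    IsDOptimal 3 g₀ ξ ↔ IsNormSquare g₀ (designMoments g₀ ξ) := by
  have hp : ∀ {ξ : OnePoint ℝ →₀ ℝ}, IsPointDesign 3 ξ →
      normPairing g₀ (designMoments g₀ ξ) = 1 := fun h => by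
    rw [normPairing_designMoments, h.2.1]
  rw [IsDOptimal, designMatrix_eq]
  constructor
  · intro h
    -- the maximal determinant is attained by a probability measure on the real line
    have h1 := mobiusDesign_isNormSquare g₀ g₀
    have hp1 := hp (mobiusDesign_isPointDesign g₀ g₀)
    obtain ⟨ρ, hρ, hm⟩ := h1.exists_infoMoments_eq g₀
    have hprob : IsProbabilityMeasure ρ := by
      rw [isProbabilityMeasure_iff_real, ← normPairing_infoMoments (g₀ := g₀), hm, hp1]
    have h2 := h ρ hprob
    rw [infoMatrix_eq, hm, h1.det_eq_maxDet hp1] at h2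
    exact isNormSquare_of_maxDet_le (hankel_designMoments_posSemidef hξ.1) (hp hξ) h2
  · intro h ρ hρ
    rw [h.det_eq_maxDet (hp hξ), infoMatrix_eq]
    exact det_hankel_le_maxDet (hankel_infoMoments_posSemidef ρ)
      (by rw [normPairing_infoMoments, probReal_univ])

/-- A matrix acting trivially on the extended line is scalar. -/
lemma exists_scalar_of_smul_eq {g h : GL (Fin 2) ℝ}
    (hgh : (fun x : OnePoint ℝ => g • x) = fun x => h • x) :
    ∃ c : ℝ, c ≠ 0 ∧ ∀ i j, g i j = c * h i j := by
  have hfix : ∀ x : OnePoint ℝ, (h⁻¹ * g) • x = x := by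
    intro x
    rw [mul_smul, congrFun hgh x, inv_smul_smul]
  set k := h⁻¹ * g with hk
  have h10 : k 1 0 = 0 := OnePoint.smul_infty_eq_self_iff.mp (hfix ∞)
  have h0 := (smul_eq_coe_iff k ((0 : ℝ) : OnePoint ℝ) 0).mp (hfix _)
  have h1 := (smul_eq_coe_iff k ((1 : ℝ) : OnePoint ℝ) 1).mp (hfix _)
  simp only [imX, imY, coordX_coe, coordY_coe, h10] at h0 h1
  have h01 : k 0 1 = 0 := by linarith
  have h11 : k 1 1 = k 0 0 := by linarith
  have hg : g = h * k := by rw [hk, mul_inv_cancel_left]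
  refine ⟨k 0 0, ?_, fun i j => ?_⟩
  · intro hzero
    exact det_entries_ne_zero k (by rw [hzero, h10]; ring)
  · rw [hg, Units.val_mul, Matrix.mul_apply, Fin.sum_univ_two]
    fin_cases j <;> simp [h10, h01, h11, mul_comm]

lemma IsNormSquare.of_scalar {g h : GL (Fin 2) ℝ} {c : ℝ} (hc : c ≠ 0)
    (hgh : ∀ i j, g i j = c * h i j) {m : Fin 5 → ℝ} (hm : IsNormSquare g m) :
    IsNormSquare h m := by
  obtain ⟨κ, hκ, hm⟩ := hm
  refine ⟨κ * c ^ 4, by positivity, fun X Y => ?_⟩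
  rw [hm]
  simp only [gNormSq, hgh]
  ring

end Designs

end TubeDesign

theorem mainTheorem2 (g₀ : GL (Fin 2) ℝ) :
    (∀ ξ : OnePoint ℝ →₀ ℝ,
      (TubeDesign.IsPointDesign 3 ξ ∧ TubeDesign.IsTubeVolumeOptimal 3 g₀ ξ) ↔
        ∃ g : GL (Fin 2) ℝ, ξ = TubeDesign.mobiusDesign 3 g₀ g) ∧
    (∀ ξ : OnePoint ℝ →₀ ℝ,
      (TubeDesign.IsPointDesign 3 ξ ∧ TubeDesign.IsDOptimal 3 g₀ ξ) ↔
        ∃ g : GL (Fin 2) ℝ,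
          (∃ r : GL (Fin 2) ℝ, TubeDesign.IsRotation r ∧
            (fun x : OnePoint ℝ => g • x) = (fun x : OnePoint ℝ => r • x) ∘ (fun x => g₀ • x)) ∧
          ξ = TubeDesign.mobiusDesign 3 g₀ g) := by
  refine ⟨fun ξ => ⟨?_, ?_⟩, fun ξ => ⟨?_, ?_⟩⟩
  · rintro ⟨hξ, hopt⟩
    obtain ⟨g, hg⟩ := TubeDesign.isTubeVolumeOptimal_iff.mp hopt
    obtain ⟨r, -, h⟩ := TubeDesign.exists_eq_mobiusDesign hξ hg
    exact ⟨r * g, h⟩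
  · rintro ⟨g, rfl⟩
    exact ⟨TubeDesign.mobiusDesign_isPointDesign g₀ g,
      TubeDesign.isTubeVolumeOptimal_iff.mpr ⟨g, TubeDesign.mobiusDesign_isNormSquare g₀ g⟩⟩
  · rintro ⟨hξ, hopt⟩
    obtain ⟨r, hr, h⟩ :=
      TubeDesign.exists_eq_mobiusDesign hξ ((TubeDesign.isDOptimal_iff hξ).mp hopt)
    exact ⟨r * g₀, ⟨r, hr, funext fun x => mul_smul r g₀ x⟩, h⟩
  · rintro ⟨g, ⟨r, hr, hg⟩, rfl⟩
    have hξ := TubeDesign.mobiusDesign_isPointDesign g₀ g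
    refine ⟨hξ, (TubeDesign.isDOptimal_iff hξ).mpr ?_⟩
    obtain ⟨c, hc, hgc⟩ := TubeDesign.exists_scalar_of_smul_eq (g := g) (h := r * g₀)
      (hg.trans (funext fun x => (mul_smul r g₀ x).symm))
    exact (TubeDesign.IsNormSquare.rotate hr).mp
      ((TubeDesign.mobiusDesign_isNormSquare g₀ g).of_scalar hc hgc)
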